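/- Let $S$ be a countable state space and let $(p(x,y))_{x,y\in S}$ be transition probabilities on $S$ (so $p(x,y)\ge 0$ and $\sum_{y} p(x,y)=1$ for every $x$). Let $X=\langle X_m\rangle_{m\ge 0}$ and $Y=\langle Y_n\rangle_{n\ge 0}$ be independent time-homogeneous Markov chains on $S$, defined on a common probability space, both with transition probabilities $p$, and with arbitrary, possibly different (deterministic or random) initial states. Assume that both chains are transient, that is, almost surely each state of $S$ is visited only finitely often by $X$ and only finitely often by $Y$. For an infinite sequence $\gamma=\langle v_0,v_1,v_2,\dots\rangle$ in $S$ in which each element of $S$ occurs only finitely often, the loop-erasure $\mathrm{LE}(\gamma)=\langle u_0,u_1,u_2,\dots\rangle$ is defined inductively by $u_0:=v_0$ and $u_{j+1}:=v_{k+1}$, where $k$ is the last index such that $v_k=u_j$. Then, almost surely on the event that the set $\{X_m : m\ge 0\}\cap\{Y_n : n\ge 0\}$ is infinite, the set $\{\mathrm{LE}(X)_j : j\ge 0\}\cap\{Y_n : n\ge 0\}$ is infinite. -/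

import Mathlib

open MeasureTheory ProbabilityTheory

namespace LoopErasedWalk

/-- The last index at which the sequence `γ` takes the value `v`. It is meaningful when `v` occurs
in `γ`, but only finitely often (`sSup` of an empty or unbounded set of naturals is `0`). -/
noncomputable def lastVisit {S : Type*} (γ : ℕ → S) (v : S) : ℕ :=
  sSup {k : ℕ | γ k = v}

/-- The loop-erasure `u` of an infinite sequence `γ` that takes each value only finitely often:
`u 0 = γ 0`, and `u (j + 1) = γ (k + 1)`, where `k` is the last index with `γ k = u j`. As `γ` is
infinite, it has no last element, so the construction never stops. -/
noncomputable def loopErasure {S : Type*} (γ : ℕ → S) : ℕ → S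
  | 0 => γ 0
  | j + 1 => γ (lastVisit γ (loopErasure γ j) + 1)

/-- `X` is a (time-homogeneous) Markov chain under `μ` with transition probabilities
`p x y = P(X (n + 1) = y | X n = x)`. The law of `X 0` is arbitrary. The field `markov` says that
`P(X (n + 1) = s (n + 1) | X 0 = s 0, …, X n = s n) = p (s n) (s (n + 1))` whenever the event
conditioned on has positive probability. -/
structure IsMarkovChain {Ω S : Type*} [MeasurableSpace Ω] [MeasurableSpace S]
    (μ : Measure Ω) (p : S → PMF S) (X : ℕ → Ω → S) : Prop where
  measurable : ∀ n, Measurable (X n)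
  markov : ∀ (n : ℕ) (s : ℕ → S),
    μ {ω | ∀ i ≤ n + 1, X i ω = s i} = μ {ω | ∀ i ≤ n, X i ω = s i} * p (s n) (s (n + 1))

/-- The process `X` is transient: almost surely, it visits each state only finitely often. -/
def IsTransient {Ω S : Type*} [MeasurableSpace Ω] (μ : Measure Ω) (X : ℕ → Ω → S) : Prop :=
  ∀ᵐ ω ∂μ, ∀ v : S, {n : ℕ | X n ω = v}.Finite

end LoopErasedWalk

/-!
Write `P` and `Q` for the laws of the two chains on the space of paths `ℕ → S`, so that the pair
has law `P.prod Q`.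

**A meeting is good with probability at least one half.** Suppose that `X m = Y n`, and let
`v` be the loop-erasure of `X 0, …, X m`. From this meeting on, the two paths are independent and
have the same law, and both of them meet `v`, since they start from its last element. By symmetry,
with probability at least `1/2` the path `Y n, Y (n + 1), …` meets `v` at an index no larger than
the first one at which `X m, X (m + 1), …` does. In this case the loop-erasure of all of `X` still
contains the point of `v` that `Y` hits, because nothing up to this point is erased after time `m`
(`IsMarkovFrom.measure_meet_le_two_mul_good`, `exists_mem_range_loopErasure`).

**Second moments.** There is no canonical meeting to which this could be applied: a meeting that is
selected with the help of the whole paths gives information on their futures. Therefore, let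
`h m n` be the indicator of `X m = Y n` divided by the number of meetings in a finite window of
times, and let `T` be the sum over this window of the conditional expectations of `h m n` given
`X m` and `Y n`. Then `𝔼[T]` is the probability that the paths meet in the window, and at least half
of `𝔼[T]` comes from good meetings. Moreover `𝔼[T²] ≤ 256 𝔼[(∑ h)²] = 256 𝔼[T]`
(`IsMarkovFrom.lintegral_sum_pairAvg_sq_le`). Indeed, conditioning on the state of a Markov chain at
time `n` amounts to conditioning on the past up to `n` and then on the future from `n`, and for
either of these monotone families of σ-algebras the dual form
`𝔼[(∑ 𝔼[hₙ|ℱₙ])²] ≤ 4 𝔼[(∑ hₙ)²]` of Doob's inequality holds (`lintegral_sum_condAvg_sq_le`).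
Hence the probability of a good meeting is at least `1/1024` times the probability of a meeting
(`IsMarkovFrom.measure_meet_le_goodSet`).

**Localization.** The same comparison holds between the events `G`, that there are good meetings at
arbitrarily late times, and `E`, that there are meetings at arbitrarily late times. It persists
after conditioning on finitely many steps of both chains. As events that depend on finitely many
steps approximate all events, `E` is almost surely contained in `G`
(`IsMarkovFrom.ae_mem_goodFrom`). On `G` the chain `Y` is in the loop-erasure of `X` at arbitrarily
late times, hence at infinitely many states, as it visits each state finitely often.
-/

namespace LoopErasedWalk

open Set
open scoped ENNReal

/-! ### Averages over the fibres of a map with countably many values -/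

section CondAvg

variable {α C : Type*} [MeasurableSpace α]

/-- The conditional expectation of `f ≥ 0` given a map `π` with countably many values: the average
of `f` over the fibre of `π` through `x`. On fibres of measure zero the value is `0`. -/
noncomputable def condAvg (μ : Measure α) (π : α → C) (f : α → ℝ≥0∞) (x : α) : ℝ≥0∞ :=
  ⨍⁻ x' in π ⁻¹' {π x}, f x' ∂μ

theorem condAvg_congr_fiber {μ : Measure α} {π : α → C} {f : α → ℝ≥0∞} {x y : α}
    (h : π x = π y) : condAvg μ π f x = condAvg μ π f y := by
  simp only [condAvg, h]

theorem condAvg_le {μ : Measure α} {π : α → C} {f : α → ℝ≥0∞} {K : ℝ≥0∞} (h : ∀ x, f x ≤ K)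
    (x : α) : condAvg μ π f x ≤ K := by
  rw [condAvg, setLAverage_eq]
  calc (∫⁻ x' in π ⁻¹' {π x}, f x' ∂μ) / μ (π ⁻¹' {π x})
      ≤ K * μ (π ⁻¹' {π x}) / μ (π ⁻¹' {π x}) := by
        gcongr
        exact (lintegral_mono fun x => h x).trans_eq (by simp)
    _ ≤ K := by
        rw [mul_div_assoc]
        exact mul_le_of_le_one_right' ENNReal.div_self_le_one

theorem condAvg_finsetSum {μ : Measure α} {π : α → C} {ι : Type*} (s : Finset ι)
    (F : ι → α → ℝ≥0∞) (hF : ∀ i ∈ s, Measurable (F i)) (x : α) :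
    condAvg μ π (fun x' => ∑ i ∈ s, F i x') x = ∑ i ∈ s, condAvg μ π (F i) x := by
  simp only [condAvg, setLAverage_eq, div_eq_mul_inv, ← Finset.sum_mul]
  rw [lintegral_finsetSum s hF]

theorem ae_fiber_ne_zero [Countable C] (μ : Measure α) (π : α → C) :
    ∀ᵐ x ∂μ, μ (π ⁻¹' {π x}) ≠ 0 := by
  rw [ae_iff]
  refine measure_mono_null (t := ⋃ c : {c : C // μ (π ⁻¹' {c}) = 0}, π ⁻¹' {c.1}) ?_ ?_
  · intro x hx
    exact mem_iUnion.2 ⟨⟨π x, not_not.1 hx⟩, rfl⟩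
  · exact measure_iUnion_null fun c => c.2

variable [MeasurableSpace C] [Countable C] [DiscreteMeasurableSpace C]

theorem lintegral_eq_tsum_fiber (μ : Measure α) {π : α → C} (hπ : Measurable π)
    (f : α → ℝ≥0∞) : ∫⁻ x, f x ∂μ = ∑' c, ∫⁻ x in π ⁻¹' {c}, f x ∂μ := by
  rw [← lintegral_iUnion (fun c => hπ (measurableSet_singleton c))
    (pairwise_disjoint_fiber π), ← preimage_iUnion, iUnion_of_singleton, preimage_univ,
    Measure.restrict_univ]

theorem measure_eq_tsum_fiber (μ : Measure α) {π : α → C} (hπ : Measurable π) (A : Set α) :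
    μ A = ∑' c, μ (A ∩ π ⁻¹' {c}) := by
  have := lintegral_eq_tsum_fiber (μ.restrict A) hπ (fun _ => 1)
  simp only [lintegral_const, one_mul, MeasurableSet.univ, Measure.restrict_apply,
    univ_inter] at this
  rw [this]
  refine tsum_congr fun c => ?_
  rw [Measure.restrict_apply (hπ (measurableSet_singleton c)), inter_comm]

theorem measure_le_mul_of_fiber {μ : Measure α} {π : α → C} (hπ : Measurable π)
    {A B : Set α} {K : ℝ≥0∞} (h : ∀ c, μ (A ∩ π ⁻¹' {c}) ≤ K * μ (B ∩ π ⁻¹' {c})) :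
    μ A ≤ K * μ B := by
  rw [measure_eq_tsum_fiber μ hπ A, measure_eq_tsum_fiber μ hπ B, ← ENNReal.tsum_mul_left]
  exact ENNReal.tsum_le_tsum h

variable {μ : Measure α} {π : α → C} {f g : α → ℝ≥0∞}

theorem measurable_condAvg (hπ : Measurable π) : Measurable (condAvg μ π f) :=
  (measurable_of_countable fun c => ⨍⁻ x' in π ⁻¹' {c}, f x' ∂μ).comp hπ

/-- The defining property of conditional expectation, tested against functions of `π`. -/
theorem lintegral_condAvg_mul [IsFiniteMeasure μ] (hπ : Measurable π) (hf : Measurable f)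
    (hg : ∀ x y, π x = π y → g x = g y) :
    ∫⁻ x, condAvg μ π f x * g x ∂μ = ∫⁻ x, f x * g x ∂μ := by
  rw [lintegral_eq_tsum_fiber μ hπ, lintegral_eq_tsum_fiber μ hπ]
  refine tsum_congr fun c => ?_
  have hm : MeasurableSet (π ⁻¹' {c}) := hπ (measurableSet_singleton c)
  rcases (π ⁻¹' {c}).eq_empty_or_nonempty with h0 | ⟨x₀, hx₀⟩
  · simp [h0]
  have hx₀ : π x₀ = c := hx₀
  have e1 : ∫⁻ x in π ⁻¹' {c}, condAvg μ π f x * g x ∂μ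
      = ∫⁻ x in π ⁻¹' {c}, condAvg μ π f x₀ * g x₀ ∂μ := by
    refine setLIntegral_congr_fun hm fun x hx => ?_
    have hx : π x = π x₀ := hx.trans hx₀.symm
    simp only [condAvg_congr_fiber hx, hg x x₀ hx]
  have hgm : ∫⁻ x in π ⁻¹' {c}, f x * g x ∂μ = ∫⁻ x in π ⁻¹' {c}, f x * g x₀ ∂μ := by
    refine setLIntegral_congr_fun hm fun x hx => ?_
    have hx : π x = π x₀ := hx.trans hx₀.symm
    simp only [hg x x₀ hx]
  rw [e1, hgm, lintegral_const, Measure.restrict_apply_univ, condAvg, hx₀, mul_right_comm,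
    mul_comm (⨍⁻ x in π ⁻¹' {c}, f x ∂μ), measure_mul_setLAverage _ (measure_ne_top _ _),
    lintegral_mul_const _ hf]

theorem lintegral_condAvg [IsFiniteMeasure μ] (hπ : Measurable π) (hf : Measurable f) :
    ∫⁻ x, condAvg μ π f x ∂μ = ∫⁻ x, f x ∂μ := by
  simpa using lintegral_condAvg_mul (μ := μ) (g := fun _ => 1) hπ hf (fun _ _ _ => rfl)

end CondAvg

/-! ### The dual maximal inequality -/

section DualDoob

variable {α ι : Type*} [MeasurableSpace α] {C : ι → Type*} [∀ i, MeasurableSpace (C i)]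
  [∀ i, Countable (C i)] [∀ i, DiscreteMeasurableSpace (C i)]

theorem two_mul_mul_le_sq_add_sq (a b : ℝ≥0∞) : 2 * (a * b) ≤ 2 * a ^ 2 + 2⁻¹ * b ^ 2 := by
  rcases eq_or_ne a ∞ with rfl | ha
  · simp [ENNReal.mul_top]
  rcases eq_or_ne b ∞ with rfl | hb
  · simp [ENNReal.mul_top]
  lift a to NNReal using ha
  lift b to NNReal using hb
  have h2 : (2⁻¹ : ℝ≥0∞) = ((2⁻¹ : NNReal) : ℝ≥0∞) := by simp
  rw [h2]
  norm_cast
  rw [← NNReal.coe_le_coe]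
  push_cast
  nlinarith [sq_nonneg (2 * (a : ℝ) - b)]

/-- The dual form of Doob's `L²` maximal inequality. The maps `π i` are such that the σ-algebras
they generate are pairwise comparable, so that the family may be increasing or decreasing. Of the
two factors of a product `𝔼[hᵢ | πᵢ] 𝔼[hⱼ | πⱼ]`, the one belonging to the finer map may then be
replaced by `hᵢ` or `hⱼ` under the integral. -/
theorem lintegral_sum_condAvg_sq_le {μ : Measure α} [IsFiniteMeasure μ] {π : ∀ i, α → C i}
    (hπ : ∀ i, Measurable (π i)) (I : Finset ι)
    (hcomp : ∀ i ∈ I, ∀ j ∈ I, (∀ x y, π j x = π j y → π i x = π i y) ∨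
      (∀ x y, π i x = π i y → π j x = π j y))
    {h : ι → α → ℝ≥0∞} (hh : ∀ i, Measurable (h i)) {K : ℝ≥0∞} (hK : K ≠ ∞)
    (hhK : ∀ i x, h i x ≤ K) :
    ∫⁻ x, (∑ i ∈ I, condAvg μ (π i) (h i) x) ^ 2 ∂μ ≤ 4 * ∫⁻ x, (∑ i ∈ I, h i x) ^ 2 ∂μ := by
  set T : ι → α → ℝ≥0∞ := fun i => condAvg μ (π i) (h i) with hT
  have hTm : ∀ i, Measurable (T i) := fun i => measurable_condAvg (hπ i)
  have hTK : ∀ i x, T i x ≤ K := fun i x => condAvg_le (hhK i) x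
  have hpair : ∀ i ∈ I, ∀ j ∈ I, ∫⁻ x, T i x * T j x ∂μ
      ≤ ∫⁻ x, h i x * T j x ∂μ + ∫⁻ x, h j x * T i x ∂μ := by
    intro i hi j hj
    rcases hcomp i hi j hj with hc | hc
    · refine le_trans (le_of_eq ?_) le_add_self
      rw [← lintegral_condAvg_mul (hπ j) (hh j)
        (fun x y hxy => condAvg_congr_fiber (hc x y hxy))]
      simp only [hT, mul_comm]
    · refine le_trans (le_of_eq ?_) le_self_add
      rw [← lintegral_condAvg_mul (hπ i) (hh i)
        (fun x y hxy => condAvg_congr_fiber (hc x y hxy))]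
  set A := ∫⁻ x, (∑ i ∈ I, T i x) ^ 2 ∂μ with hA
  set B := ∫⁻ x, (∑ i ∈ I, h i x) ^ 2 ∂μ with hB
  -- finiteness of `A`, which is what boundedness of the `h i` is for, allows to absorb `2⁻¹ * A`
  have hAtop : A ≠ ∞ := by
    refine ne_top_of_le_ne_top (b := ∫⁻ _, (I.card * K) ^ 2 ∂μ) ?_ (lintegral_mono fun x => ?_)
    · rw [lintegral_const]
      exact ENNReal.mul_ne_top (ENNReal.pow_ne_top (ENNReal.mul_ne_top (by simp) hK))
        (measure_ne_top _ _)
    · gcongr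
      exact (Finset.sum_le_sum fun i _ => hTK i x).trans_eq (by simp)
  have h1 : A ≤ 2 * ∫⁻ x, (∑ i ∈ I, h i x) * (∑ j ∈ I, T j x) ∂μ := by
    have e1 : A = ∑ i ∈ I, ∑ j ∈ I, ∫⁻ x, T i x * T j x ∂μ := by
      simp only [hA, sq, Finset.sum_mul_sum]
      rw [lintegral_finsetSum _ (by fun_prop)]
      exact Finset.sum_congr rfl fun i _ => lintegral_finsetSum _ (by fun_prop)
    have e2 : ∫⁻ x, (∑ i ∈ I, h i x) * (∑ j ∈ I, T j x) ∂μ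
        = ∑ i ∈ I, ∑ j ∈ I, ∫⁻ x, h i x * T j x ∂μ := by
      simp only [Finset.sum_mul_sum]
      rw [lintegral_finsetSum _ (by fun_prop)]
      exact Finset.sum_congr rfl fun i _ => lintegral_finsetSum _ (by fun_prop)
    rw [e1, e2, two_mul]
    calc _ ≤ ∑ i ∈ I, ∑ j ∈ I, (∫⁻ x, h i x * T j x ∂μ + ∫⁻ x, h j x * T i x ∂μ) :=
          Finset.sum_le_sum fun i hi => Finset.sum_le_sum fun j hj => hpair i hi j hj
      _ = _ := by
          simp only [Finset.sum_add_distrib]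
          congr 1
          exact Finset.sum_comm
  have h2 : A ≤ 2 * B + 2⁻¹ * A := by
    refine h1.trans ?_
    rw [← lintegral_const_mul _ (by fun_prop), hA, hB, ← lintegral_const_mul _ (by fun_prop),
      ← lintegral_const_mul _ (by fun_prop), ← lintegral_add_left (by fun_prop)]
    exact lintegral_mono fun x => two_mul_mul_le_sq_add_sq _ _
  have h3 : 2⁻¹ * A + 2⁻¹ * A ≤ 2 * B + 2⁻¹ * A := by
    rwa [← add_mul, ENNReal.inv_two_add_inv_two, one_mul]
  have h4 : 2⁻¹ * A ≤ 2 * B :=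
    (ENNReal.add_le_add_iff_right (ENNReal.mul_ne_top (by simp) hAtop)).1 h3
  calc A = 2 * (2⁻¹ * A) := by
        rw [← mul_assoc, ENNReal.mul_inv_cancel (by simp) (by simp), one_mul]
    _ ≤ 2 * (2 * B) := by gcongr
    _ = 4 * B := by rw [← mul_assoc]; norm_num

end DualDoob

/-! ### Markov measures on the space of paths -/

section Paths

variable {S : Type*}

/-- The part of a path seen at the times in a finite set `I`. -/
def window (I : Finset ℕ) (γ : ℕ → S) : I → S := fun i => γ i

theorem window_eq_window_iff {I : Finset ℕ} {γ γ' : ℕ → S} :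
    window I γ = window I γ' ↔ ∀ i ∈ I, γ i = γ' i := by
  simp [funext_iff, window]

/-- The path from time `n` on. -/
def shift (n : ℕ) (γ : ℕ → S) : ℕ → S := fun i => γ (n + i)

variable [MeasurableSpace S]

theorem measurable_window (I : Finset ℕ) : Measurable (window (S := S) I) :=
  measurable_pi_lambda _ fun _ => measurable_pi_apply _

theorem measurable_shift (n : ℕ) : Measurable (shift (S := S) n) :=
  measurable_pi_lambda _ fun _ => measurable_pi_apply _

/-- `P` is the law of a path that evolves from time `k` on as a Markov chain with transition
probabilities `p`. Nothing is required of the first `k` steps, so the class is stable under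
conditioning on the path up to time `k`. The measure `P` need not be normalized. -/
def IsMarkovFrom (p : S → PMF S) (k : ℕ) (P : Measure (ℕ → S)) : Prop :=
  ∀ n, k ≤ n → ∀ s : ℕ → S,
    P {γ | ∀ i ≤ n + 1, γ i = s i} = P {γ | ∀ i ≤ n, γ i = s i} * p (s n) (s (n + 1))

variable {p : S → PMF S} {k : ℕ} {P Q : Measure (ℕ → S)}

theorem IsMarkovFrom.measure_cylinder (hP : IsMarkovFrom p k P) {n M : ℕ} (hkn : k ≤ n)
    (hnM : n ≤ M) (s : ℕ → S) :
    P {γ | ∀ i ≤ M, γ i = s i}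
      = P {γ | ∀ i ≤ n, γ i = s i} * ∏ i ∈ Finset.Ico n M, p (s i) (s (i + 1)) := by
  induction M, hnM using Nat.le_induction with
  | base => simp
  | succ M hM ih =>
    rw [hP M (hkn.trans hM) s, ih, Finset.prod_Ico_succ_top hM, mul_assoc]

variable [Countable S] [DiscreteMeasurableSpace S]

theorem measurableSet_coord_eq (n : ℕ) (z : S) : MeasurableSet {γ : ℕ → S | γ n = z} :=
  (measurable_pi_apply (X := fun _ => S) n) (measurableSet_singleton z)

theorem measurableSet_forall_coord_eq (I : Finset ℕ) (y : ℕ → S) :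
    MeasurableSet {γ : ℕ → S | ∀ i ∈ I, γ i = y i} := by
  have : {γ : ℕ → S | ∀ i ∈ I, γ i = y i} = ⋂ i ∈ I, {γ | γ i = y i} := by ext; simp
  rw [this]
  exact Finset.measurableSet_biInter _ fun i _ => measurableSet_coord_eq i _

theorem measurableSet_forall_le_coord_eq (n : ℕ) (y : ℕ → S) :
    MeasurableSet {γ : ℕ → S | ∀ i ≤ n, γ i = y i} := by
  simpa using measurableSet_forall_coord_eq (Finset.Iic n) y

/-- The Markov property: given the state at time `n`, an event of the past and a cylinder of the
future are independent. -/
theorem IsMarkovFrom.measure_past_inter_future (hP : IsMarkovFrom p k P) {n M : ℕ} (hkn : k ≤ n)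
    (hnM : n ≤ M) (B : Set (Finset.Iic n → S)) (y : ℕ → S) :
    P (window (Finset.Iic n) ⁻¹' B ∩ {γ | ∀ i ∈ Finset.Icc n M, γ i = y i})
      = (∏ i ∈ Finset.Ico n M, p (y i) (y (i + 1)))
        * P (window (Finset.Iic n) ⁻¹' B ∩ {γ | γ n = y n}) := by
  have hm : Measurable (window (S := S) (Finset.Iic n)) := measurable_window _
  rw [measure_eq_tsum_fiber P hm, measure_eq_tsum_fiber P hm, ← ENNReal.tsum_mul_left]
  refine tsum_congr fun c => ?_
  rcases (window (S := S) (Finset.Iic n) ⁻¹' {c}).eq_empty_or_nonempty with h0 | ⟨x, rfl⟩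
  · simp [h0]
  have hx : ∀ γ : ℕ → S, window (Finset.Iic n) γ = window (Finset.Iic n) x ↔
      ∀ i ≤ n, γ i = x i := fun γ => by
    simpa using window_eq_window_iff (I := Finset.Iic n) (γ := γ) (γ' := x)
  -- on the fibre of the past through `x`, both events are cylinders, or both are empty
  by_cases hB : window (Finset.Iic n) x ∈ B ∧ x n = y n
  · have e1 : window (Finset.Iic n) ⁻¹' B ∩ {γ | ∀ i ∈ Finset.Icc n M, γ i = y i} ∩
        window (Finset.Iic n) ⁻¹' {window (Finset.Iic n) x}
        = {γ | ∀ i ≤ M, γ i = if i ≤ n then x i else y i} := by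
      ext γ
      simp only [mem_inter_iff, mem_preimage, mem_singleton_iff, hx, mem_ofPred_eq,
        Finset.mem_Icc]
      constructor
      · rintro ⟨⟨-, h1⟩, h2⟩ i hi
        split_ifs with h
        · exact h2 i h
        · exact h1 i ⟨by omega, hi⟩
      · intro h
        have h2 : ∀ i ≤ n, γ i = x i := fun i hi => by
          have := h i (hi.trans hnM)
          rwa [if_pos hi] at this
        refine ⟨⟨?_, fun i hi => ?_⟩, h2⟩
        · rw [(hx γ).2 h2]; exact hB.1
        · rcases hi.1.eq_or_lt with rfl | h3
          · rw [h2 _ le_rfl, hB.2]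
          · have := h i hi.2
            rwa [if_neg (by omega)] at this
    have e2 : window (Finset.Iic n) ⁻¹' B ∩ {γ | γ n = y n} ∩
        window (Finset.Iic n) ⁻¹' {window (Finset.Iic n) x}
        = {γ | ∀ i ≤ n, γ i = if i ≤ n then x i else y i} := by
      ext γ
      simp only [mem_inter_iff, mem_preimage, mem_singleton_iff, hx, mem_ofPred_eq]
      constructor
      · rintro ⟨-, h2⟩ i hi
        rw [if_pos hi, h2 i hi]
      · intro h
        have h2 : ∀ i ≤ n, γ i = x i := fun i hi => by
          have := h i hi
          rwa [if_pos hi] at this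
        refine ⟨⟨?_, ?_⟩, h2⟩
        · rw [(hx γ).2 h2]; exact hB.1
        · rw [h2 _ le_rfl, hB.2]
    rw [e1, e2, hP.measure_cylinder hkn hnM, mul_comm]
    congr 1
    refine Finset.prod_congr rfl fun i hi => ?_
    rw [Finset.mem_Ico] at hi
    have h1 : (if i ≤ n then x i else y i) = y i := by
      split_ifs with h
      · rw [show i = n by omega, hB.2]
      · rfl
    rw [h1, if_neg (by omega)]
  · have e1 : window (Finset.Iic n) ⁻¹' B ∩ {γ | γ n = y n} ∩
        window (Finset.Iic n) ⁻¹' {window (Finset.Iic n) x} = ∅ := by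
      refine eq_empty_of_forall_notMem ?_
      rintro γ ⟨⟨h1, h2⟩, h3⟩
      refine hB ⟨?_, ?_⟩
      · rw [← (show _ = _ from h3)]; exact h1
      · rw [← (hx γ).1 h3 n le_rfl]; exact h2
    have e2 : window (Finset.Iic n) ⁻¹' B ∩ {γ | ∀ i ∈ Finset.Icc n M, γ i = y i} ∩
        window (Finset.Iic n) ⁻¹' {window (Finset.Iic n) x} = ∅ := by
      refine subset_empty_iff.1 (Subset.trans ?_ e1.subset)
      rintro γ ⟨⟨h1, h2⟩, h3⟩
      exact ⟨⟨h1, h2 n (Finset.mem_Icc.2 ⟨le_rfl, hnM⟩)⟩, h3⟩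
    rw [e1, e2]
    simp

/-- Conditioning on the present is conditioning on the past followed by conditioning on the
future. -/
theorem IsMarkovFrom.condAvg_coord_ae_eq [IsFiniteMeasure P] (hP : IsMarkovFrom p k P) {n M : ℕ}
    (hkn : k ≤ n) (hnM : n ≤ M) {f : (ℕ → S) → ℝ≥0∞} (hf : Measurable f) :
    ∀ᵐ y ∂P, condAvg P (fun γ => γ n) f y
      = condAvg P (window (Finset.Icc n M)) (condAvg P (window (Finset.Iic n)) f) y := by
  filter_upwards [ae_fiber_ne_zero P (window (S := S) (Finset.Icc n M))] with y hy
  have hm : Measurable (window (S := S) (Finset.Iic n)) := measurable_window _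
  set q := ∏ i ∈ Finset.Ico n M, p (y i) (y (i + 1)) with hq
  set F := {γ : ℕ → S | ∀ i ∈ Finset.Icc n M, γ i = y i} with hF
  set Z := {γ : ℕ → S | γ n = y n} with hZ
  have hFy : window (S := S) (Finset.Icc n M) ⁻¹' {window (Finset.Icc n M) y} = F := by
    ext γ
    exact window_eq_window_iff
  have hFZ : P F = q * P Z := by
    simpa only [preimage_univ, univ_inter] using hP.measure_past_inter_future hkn hnM univ y
  rw [hFy, hFZ] at hy
  have hq0 : q ≠ 0 := left_ne_zero_of_mul hy
  have hqtop : q ≠ ∞ := ENNReal.prod_ne_top fun i _ => PMF.apply_ne_top _ _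
  -- by the Markov property, conditioning on the future gives the past the same law, up to the
  -- factor `q`, as conditioning on the present
  have hmap : (P.restrict F).map (window (Finset.Iic n))
      = q • (P.restrict Z).map (window (Finset.Iic n)) := by
    ext B hB
    rw [Measure.smul_apply, Measure.map_apply hm hB, Measure.map_apply hm hB,
      Measure.restrict_apply (hm hB), Measure.restrict_apply (hm hB),
      hP.measure_past_inter_future hkn hnM B y, smul_eq_mul]
  have hint : ∫⁻ γ in F, condAvg P (window (Finset.Iic n)) f γ ∂P = q * ∫⁻ γ in Z, f γ ∂P := by
    have hψ : ∀ ν : Measure (ℕ → S), (∫⁻ γ, condAvg P (window (Finset.Iic n)) f γ ∂ν)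
        = ∫⁻ c, (⨍⁻ x' in window (Finset.Iic n) ⁻¹' {c}, f x' ∂P)
            ∂(ν.map (window (Finset.Iic n))) := fun ν =>
      (lintegral_map (f := fun c => ⨍⁻ x' in window (Finset.Iic n) ⁻¹' {c}, f x' ∂P)
        (measurable_of_countable _) hm).symm
    have hZm : MeasurableSet Z := measurableSet_coord_eq n _
    rw [hψ, hmap, lintegral_smul_measure, ← hψ, smul_eq_mul]
    congr 1
    have := lintegral_condAvg_mul (μ := P) (g := Z.indicator 1) hm hf (fun x x' hxx' => by
      have h : x n = x' n := window_eq_window_iff.1 hxx' n (by simp)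
      have hxZ : x ∈ Z ↔ x' ∈ Z := by rw [hZ, mem_ofPred_eq, mem_ofPred_eq, h]
      by_cases hz : x' ∈ Z
      · simp [hz, hxZ.2 hz]
      · simp [hz, mt hxZ.1 hz])
    have hind : ∀ φ : (ℕ → S) → ℝ≥0∞, ∫⁻ x, φ x * Z.indicator 1 x ∂P = ∫⁻ x in Z, φ x ∂P := by
      intro φ
      rw [← lintegral_indicator hZm]
      refine lintegral_congr fun x => ?_
      by_cases hx : x ∈ Z <;> simp [hx]
    rwa [hind, hind] at this
  rw [condAvg, condAvg, setLAverage_eq, setLAverage_eq, hFy, hFZ, hint,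
    ENNReal.mul_div_mul_left _ _ hq0 hqtop]
  rfl

/-- The dual maximal inequality for conditional expectations given the single coordinates of a
Markov chain: it follows from the one for the increasing family of pasts and the one for the
decreasing family of futures. -/
theorem IsMarkovFrom.lintegral_sum_condAvg_coord_sq_le [IsFiniteMeasure P]
    (hP : IsMarkovFrom p k P) {M : ℕ} {I : Finset ℕ} (hI : ∀ n ∈ I, k ≤ n ∧ n ≤ M)
    {h : ℕ → (ℕ → S) → ℝ≥0∞} (hh : ∀ n, Measurable (h n)) {K : ℝ≥0∞} (hK : K ≠ ∞)
    (hhK : ∀ n γ, h n γ ≤ K) :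
    ∫⁻ γ, (∑ n ∈ I, condAvg P (fun γ' => γ' n) (h n) γ) ^ 2 ∂P
      ≤ 16 * ∫⁻ γ, (∑ n ∈ I, h n γ) ^ 2 ∂P := by
  have hm : ∀ J : Finset ℕ, Measurable (window (S := S) J) :=
    fun J => measurable_window _
  have hae : ∀ᵐ γ ∂P, ∀ n ∈ I, condAvg P (fun γ' => γ' n) (h n) γ
      = condAvg P (window (Finset.Icc n M)) (condAvg P (window (Finset.Iic n)) (h n)) γ := by
    rw [ae_all_iff]
    intro n
    by_cases hn : n ∈ I
    · filter_upwards [hP.condAvg_coord_ae_eq (hI n hn).1 (hI n hn).2 (hh n)] with γ hγ _ using hγ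
    · exact Filter.Eventually.of_forall fun γ h => absurd h hn
  have hcomp : ∀ {J J' : Finset ℕ}, J ⊆ J' → ∀ x y : ℕ → S,
      window J' x = window J' y → window J x = window J y := fun hJ x y hxy =>
    window_eq_window_iff.2 fun i hi => window_eq_window_iff.1 hxy i (hJ hi)
  calc ∫⁻ γ, (∑ n ∈ I, condAvg P (fun γ' => γ' n) (h n) γ) ^ 2 ∂P
      = ∫⁻ γ, (∑ n ∈ I, condAvg P (window (Finset.Icc n M))
          (condAvg P (window (Finset.Iic n)) (h n)) γ) ^ 2 ∂P := by
        refine lintegral_congr_ae ?_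
        filter_upwards [hae] with γ hγ
        rw [Finset.sum_congr rfl hγ]
    _ ≤ 4 * ∫⁻ γ, (∑ n ∈ I, condAvg P (window (Finset.Iic n)) (h n) γ) ^ 2 ∂P := by
        refine lintegral_sum_condAvg_sq_le (π := fun n => window (Finset.Icc n M))
          (fun n => hm _) I (fun i _ j _ => ?_)
          (h := fun n => condAvg P (window (Finset.Iic n)) (h n))
          (fun n => measurable_condAvg (hm _)) hK (fun n γ => condAvg_le (hhK n) γ)
        rcases le_total i j with hij | hij
        · exact Or.inr (hcomp (Finset.Icc_subset_Icc_left hij))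
        · exact Or.inl (hcomp (Finset.Icc_subset_Icc_left hij))
    _ ≤ 4 * (4 * ∫⁻ γ, (∑ n ∈ I, h n γ) ^ 2 ∂P) := by
        gcongr
        refine lintegral_sum_condAvg_sq_le (π := fun n => window (Finset.Iic n))
          (fun n => hm _) I (fun i _ j _ => ?_) hh hK hhK
        rcases le_total i j with hij | hij
        · exact Or.inl (hcomp (Finset.Iic_subset_Iic.2 hij))
        · exact Or.inr (hcomp (Finset.Iic_subset_Iic.2 hij))
    _ = 16 * ∫⁻ γ, (∑ n ∈ I, h n γ) ^ 2 ∂P := by rw [← mul_assoc]; norm_num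

/-- A finite measure on paths is determined by its values on cylinders. -/
theorem measure_path_ext {α β : Measure (ℕ → S)} [IsFiniteMeasure α] [IsFiniteMeasure β]
    (h : ∀ n (s : ℕ → S), α {γ | ∀ i ≤ n, γ i = s i} = β {γ | ∀ i ≤ n, γ i = s i}) : α = β := by
  have hβ : IsProjectiveLimit (α := fun _ => S) β fun J : Finset ℕ => β.map (window (S := S) J) :=
    fun J => rfl
  have hproj : IsProjectiveMeasureFamily (α := fun _ => S)
      fun J : Finset ℕ => β.map (window (S := S) J) := by
    intro I J hJI
    exact (Measure.map_map (Finset.measurable_restrict₂ (X := fun _ => S) hJI)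
      (measurable_window (S := S) I)).symm
  refine IsProjectiveLimit.unique ((isProjectiveLimit_nat_iff hproj α).2 fun n => ?_) hβ
  refine Measure.ext_of_singleton fun c => ?_
  rw [Measure.map_apply (measurable_window _) (measurableSet_singleton c)]
  change α.map (window (Finset.Iic n)) {c} = _
  rw [Measure.map_apply (measurable_window _) (measurableSet_singleton c)]
  rcases (window (S := S) (Finset.Iic n) ⁻¹' {c}).eq_empty_or_nonempty with h0 | ⟨x, rfl⟩
  · simp [h0]
  have : window (Finset.Iic n) ⁻¹' {window (Finset.Iic n) x} = {γ | ∀ i ≤ n, γ i = x i} := by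
    ext γ
    simpa using window_eq_window_iff (I := Finset.Iic n) (γ := γ) (γ' := x)
  rw [this, h]

open Classical in
/-- Given the state at a time `n ≥ k`, the path from time `n` on has a law that depends neither on
the past, nor on `n`, nor on the initial distribution. -/
theorem IsMarkovFrom.smul_map_shift_eq [IsFiniteMeasure P] [IsFiniteMeasure Q]
    (hP : IsMarkovFrom p k P) (hQ : IsMarkovFrom p k Q) {m n : ℕ} (hm : k ≤ m) (hn : k ≤ n)
    (A : Set (Finset.Iic m → S)) (B : Set (Finset.Iic n → S)) (z : S) :
    Q (window (Finset.Iic n) ⁻¹' B ∩ {γ | γ n = z}) •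
        (P.restrict (window (Finset.Iic m) ⁻¹' A ∩ {γ | γ m = z})).map (shift m)
      = P (window (Finset.Iic m) ⁻¹' A ∩ {γ | γ m = z}) •
        (Q.restrict (window (Finset.Iic n) ⁻¹' B ∩ {γ | γ n = z})).map (shift n) := by
  have key : ∀ {R : Measure (ℕ → S)}, IsMarkovFrom p k R → ∀ {l : ℕ}, k ≤ l →
      ∀ (D : Set (Finset.Iic l → S)) (N : ℕ) (s : ℕ → S),
      (R.restrict (window (Finset.Iic l) ⁻¹' D ∩ {γ | γ l = z})).map (shift l)
        {γ | ∀ i ≤ N, γ i = s i} = (if s 0 = z then ∏ i ∈ Finset.range N, p (s i) (s (i + 1))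
          else 0) * R (window (Finset.Iic l) ⁻¹' D ∩ {γ | γ l = z}) := by
    intro R hR l hl D N s
    rw [Measure.map_apply (measurable_shift l) (measurableSet_forall_le_coord_eq N s),
      Measure.restrict_apply (measurable_shift l (measurableSet_forall_le_coord_eq N s))]
    split_ifs with h
    · have := hR.measure_past_inter_future hl (Nat.le_add_right l N) D (fun i => s (i - l))
      rw [Finset.prod_Ico_eq_prod_range] at this
      simp only [Nat.sub_self, h, Nat.add_sub_cancel_left, Nat.add_assoc] at this
      rw [← this]
      congr 1
      ext γ
      simp only [mem_inter_iff, mem_preimage, mem_ofPred_eq, shift, Finset.mem_Icc]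
      constructor
      · rintro ⟨h1, h2, h3⟩
        refine ⟨h2, fun i hi => ?_⟩
        rw [← h1 (i - l) (by omega), Nat.add_sub_cancel' hi.1]
      · rintro ⟨h1, h2⟩
        refine ⟨fun i hi => ?_, h1, ?_⟩
        · rw [h2 (l + i) (by omega), Nat.add_sub_cancel_left]
        · rw [h2 l (by omega), Nat.sub_self, h]
    · rw [zero_mul]
      convert measure_empty (μ := R)
      refine eq_empty_of_forall_notMem ?_
      rintro γ ⟨h1, -, h2⟩
      exact h ((h1 0 (Nat.zero_le _)).symm.trans h2)
  have := Measure.smul_finite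
    ((P.restrict (window (Finset.Iic m) ⁻¹' A ∩ {γ | γ m = z})).map (shift m))
    (measure_ne_top Q (window (Finset.Iic n) ⁻¹' B ∩ {γ | γ n = z}))
  have := Measure.smul_finite
    ((Q.restrict (window (Finset.Iic n) ⁻¹' B ∩ {γ | γ n = z})).map (shift n))
    (measure_ne_top P (window (Finset.Iic m) ⁻¹' A ∩ {γ | γ m = z}))
  refine measure_path_ext fun N s => ?_
  rw [Measure.smul_apply, Measure.smul_apply, key hP hm, key hQ hn, smul_eq_mul, smul_eq_mul]
  ring

end Paths

/-! ### Loop erasure of a finite path, and paths that meet it -/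

section FiniteErasure

variable {S : Type*}

/-- The loop-erasure of the finite path `γ 0, …, γ m`, prolonged to an infinite sequence by
repeating its last element `γ m`. -/
noncomputable def finiteErasure (m : ℕ) (γ : ℕ → S) : ℕ → S
  | 0 => γ 0
  | j + 1 => γ (min (sSup {k | k ≤ m ∧ γ k = finiteErasure m γ j} + 1) m)

theorem finiteErasure_congr {m : ℕ} {γ γ' : ℕ → S} (h : ∀ i ≤ m, γ i = γ' i) (j : ℕ) :
    finiteErasure m γ j = finiteErasure m γ' j := by
  induction j with
  | zero => exact h 0 (Nat.zero_le _)
  | succ j ih =>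
    have hs : {k | k ≤ m ∧ γ k = finiteErasure m γ j}
        = {k | k ≤ m ∧ γ' k = finiteErasure m γ' j} := by
      ext k
      simp only [mem_ofPred_eq, ih]
      exact and_congr_right fun hk => by rw [h k hk]
    rw [finiteErasure, finiteErasure, hs]
    exact h _ (min_le_right _ _)

theorem exists_eq_finiteErasure (m : ℕ) (γ : ℕ → S) (j : ℕ) :
    ∃ k, k ≤ m ∧ γ k = finiteErasure m γ j := by
  cases j with
  | zero => exact ⟨0, Nat.zero_le _, rfl⟩
  | succ j => exact ⟨_, min_le_right _ _, rfl⟩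

/-- Each step of the loop-erasure advances in time, so that it ends after at most `m` steps. -/
theorem min_le_sSup_finiteErasure (m : ℕ) (γ : ℕ → S) (j : ℕ) :
    min j m ≤ sSup {k | k ≤ m ∧ γ k = finiteErasure m γ j} := by
  have hb : ∀ v, BddAbove {k | k ≤ m ∧ γ k = v} := fun v => ⟨m, fun k hk => hk.1⟩
  induction j with
  | zero => simp
  | succ j ih =>
    exact (by omega : min (j + 1) m ≤ _).trans (le_csSup (hb _) ⟨min_le_right _ _, rfl⟩)

theorem finiteErasure_self (m : ℕ) (γ : ℕ → S) : finiteErasure m γ m = γ m := by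
  cases m with
  | zero => rfl
  | succ m =>
    have := min_le_sSup_finiteErasure (m + 1) γ m
    rw [finiteErasure, min_eq_right (by omega)]

/-- The loop-erasure of `γ` agrees with that of `γ 0, …, γ m` up to the first state of the latter
that `γ` visits at time `m` or later. -/
theorem loopErasure_eq_finiteErasure {m : ℕ} {γ : ℕ → S} {j : ℕ}
    (h : ∀ i < j, ∀ l, γ (m + l) ≠ finiteErasure m γ i) :
    loopErasure γ j = finiteErasure m γ j := by
  induction j with
  | zero => rfl
  | succ j ih =>
    have ih := ih fun i hi => h i (hi.trans (Nat.lt_succ_self j))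
    have hlt : ∀ k, γ k = finiteErasure m γ j → k < m := by
      intro k hk
      by_contra hkm
      refine h j (Nat.lt_succ_self j) (k - m) ?_
      rw [Nat.add_sub_cancel' (not_lt.1 hkm), hk]
    have hset : {k | γ k = finiteErasure m γ j} = {k | k ≤ m ∧ γ k = finiteErasure m γ j} :=
      Set.ext fun k => ⟨fun hk => ⟨(hlt k hk).le, hk⟩, fun hk => hk.2⟩
    have hm : sSup {k | k ≤ m ∧ γ k = finiteErasure m γ j} + 1 ≤ m :=
      hlt _ (Nat.sSup_mem (exists_eq_finiteErasure m γ j) ⟨m, fun k hk => hk.1⟩).2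
    rw [loopErasure, ih, lastVisit, hset, finiteErasure, min_eq_left hm]

/-- The path `t` meets the sequence `v`, and at an index at which, or before which, `s` meets it
first, if it does so at all. -/
def MeetsNoLater (v s t : ℕ → S) : Prop :=
  ∃ j, (∃ i, t i = v j) ∧ ∀ i < j, ∀ l, s l ≠ v i

theorem meetsNoLater_total {v s t : ℕ → S} (h : ∃ j i, t i = v j) :
    MeetsNoLater v s t ∨ MeetsNoLater v t s := by
  classical
  have hex : ∃ j, (∃ i, t i = v j) ∨ ∃ i, s i = v j := h.imp fun _ => Or.inl
  have hmin : ∀ i < Nat.find hex, (∀ l, t l ≠ v i) ∧ ∀ l, s l ≠ v i := fun i hi => by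
    simpa using Nat.find_min hex hi
  rcases Nat.find_spec hex with h1 | h1
  · exact Or.inl ⟨_, h1, fun i hi => (hmin i hi).2⟩
  · exact Or.inr ⟨_, h1, fun i hi => (hmin i hi).1⟩

/-- The pairs of paths that meet at times `m` and `n`, and such that from then on the second one
meets the loop-erasure of the first one up to time `m` no later than the first one does. -/
def goodSet (m n : ℕ) : Set ((ℕ → S) × (ℕ → S)) :=
  {w | w.1 m = w.2 n ∧ MeetsNoLater (finiteErasure m w.1) (shift m w.1) (shift n w.2)}

/-- On the good event, the second path hits the loop-erasure of the whole first path after time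
`n`: the part of the finite loop-erasure up to the point where the second path meets it is not
erased later. -/
theorem exists_mem_range_loopErasure {m n : ℕ} {x y : ℕ → S} (h : (x, y) ∈ goodSet m n) :
    ∃ i, n ≤ i ∧ y i ∈ range (loopErasure x) := by
  obtain ⟨-, j, ⟨i, hi⟩, hj⟩ := h
  exact ⟨n + i, Nat.le_add_right n i, j, (loopErasure_eq_finiteErasure hj).trans hi.symm⟩

variable [MeasurableSpace S]

theorem measurable_fst_coord (m : ℕ) : Measurable fun w : (ℕ → S) × (ℕ → S) => w.1 m :=
  (measurable_pi_apply m).comp measurable_fst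

theorem measurable_snd_coord (n : ℕ) : Measurable fun w : (ℕ → S) × (ℕ → S) => w.2 n :=
  (measurable_pi_apply n).comp measurable_snd

variable [Countable S] [DiscreteMeasurableSpace S]

theorem measurable_finiteErasure (m j : ℕ) :
    Measurable fun γ : ℕ → S => finiteErasure m γ j := by
  have : (fun γ : ℕ → S => finiteErasure m γ j)
      = (fun c : Finset.Iic m → S => finiteErasure m (fun i => c ⟨min i m, by simp⟩) j) ∘
        window (Finset.Iic m) := by
    ext γ
    exact finiteErasure_congr (fun i hi => by simp [window, hi]) j
  rw [this]
  exact (measurable_of_countable _).comp (measurable_window _)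

theorem measurableSet_meetsNoLater {α : Type*} [MeasurableSpace α] {v s t : α → ℕ → S}
    (hv : ∀ i, Measurable fun a => v a i) (hs : ∀ i, Measurable fun a => s a i)
    (ht : ∀ i, Measurable fun a => t a i) :
    MeasurableSet {a | MeetsNoLater (v a) (s a) (t a)} := by
  have : {a | MeetsNoLater (v a) (s a) (t a)} = ⋃ j, (⋃ i, {a | t a i = v a j}) ∩
      ⋂ i, ⋂ (_ : i < j), ⋂ l, {a | s a l = v a i}ᶜ := by
    ext a
    simp [MeetsNoLater]
  rw [this]
  refine MeasurableSet.iUnion fun j => (MeasurableSet.iUnion fun i => ?_).inter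
    (MeasurableSet.iInter fun i => MeasurableSet.iInter fun _ => MeasurableSet.iInter fun l => ?_)
  · exact measurableSet_eq_fun (ht i) (hv j)
  · exact (measurableSet_eq_fun (hs l) (hv i)).compl

theorem measurableSet_meetsNoLater_shift (m n : ℕ) : MeasurableSet {w : (ℕ → S) × (ℕ → S) |
    MeetsNoLater (finiteErasure m w.1) (shift m w.1) (shift n w.2)} :=
  measurableSet_meetsNoLater (fun i => (measurable_finiteErasure m i).comp measurable_fst)
    (fun _ => measurable_fst_coord _) (fun _ => measurable_snd_coord _)

theorem measurableSet_goodSet (m n : ℕ) : MeasurableSet (goodSet (S := S) m n) :=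
  (measurableSet_eq_fun (measurable_fst_coord m) (measurable_snd_coord n)).inter
    (measurableSet_meetsNoLater_shift m n)

/-- Two independent paths with the same law are exchangeable, so that each of them meets `v` no
later than the other one with probability at least one half. -/
theorem measure_univ_mul_le_two_mul_meetsNoLater {α β : Measure (ℕ → S)} [IsFiniteMeasure α]
    [IsFiniteMeasure β] (hαβ : β univ • α = α univ • β) {v : ℕ → S} {j : ℕ}
    (hβ : β {s | s 0 = v j} = β univ) :
    α univ * β univ ≤ 2 * (α.prod β) {w | MeetsNoLater v w.1 w.2} := by
  rcases eq_or_ne (β univ) 0 with h0 | h0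
  · simp [h0]
  set D := {w : (ℕ → S) × (ℕ → S) | MeetsNoLater v w.1 w.2} with hD
  have hDm : MeasurableSet D := measurableSet_meetsNoLater (fun i => measurable_const)
    (fun _ => measurable_fst_coord _) (fun _ => measurable_snd_coord _)
  -- each pair of paths from `v j` lies in `D` or in its mirror image
  have hββ : β univ * β univ ≤ 2 * (β.prod β) D := by
    calc β univ * β univ = (β.prod β) ({s | s 0 = v j} ×ˢ {s | s 0 = v j}) := by
          rw [Measure.prod_prod, hβ]
      _ ≤ (β.prod β) (D ∪ Prod.swap ⁻¹' D) := by
          refine measure_mono fun w hw => ?_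
          exact meetsNoLater_total ⟨j, 0, hw.2⟩
      _ ≤ (β.prod β) D + (β.prod β) (Prod.swap ⁻¹' D) := measure_union_le _ _
      _ = 2 * (β.prod β) D := by
          rw [← Measure.map_apply measurable_swap hDm, Measure.prod_swap, two_mul]
  have hprod : β univ * (α.prod β) D = α univ * (β.prod β) D := by
    have := congrArg (fun ν : Measure (ℕ → S) => (ν.prod β) D) hαβ
    simpa [Measure.prod_smul_left] using this
  refine (ENNReal.mul_le_mul_iff_right h0 (measure_ne_top β univ)).1 ?_
  calc β univ * (α univ * β univ) = α univ * (β univ * β univ) := by ring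
    _ ≤ α univ * (2 * (β.prod β) D) := by gcongr
    _ = β univ * (2 * (α.prod β) D) := by
        rw [mul_left_comm, ← hprod, mul_left_comm]

variable {p : S → PMF S} {k : ℕ} {P Q : Measure (ℕ → S)}

/-- Given that the two chains are at `z` at times `m` and `n`, the good event has conditional
probability at least one half. -/
theorem IsMarkovFrom.measure_meet_le_two_mul_good [IsFiniteMeasure P] [IsFiniteMeasure Q]
    (hP : IsMarkovFrom p k P) (hQ : IsMarkovFrom p k Q) {m n : ℕ} (hm : k ≤ m) (hn : k ≤ n)
    (z : S) :
    (P.prod Q) {w | w.1 m = z ∧ w.2 n = z}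
      ≤ 2 * (P.prod Q) ({w | w.1 m = z ∧ w.2 n = z} ∩ goodSet m n) := by
  have hπ : Measurable fun w : (ℕ → S) × (ℕ → S) => window (Finset.Iic m) w.1 :=
    (measurable_window _).comp measurable_fst
  refine measure_le_mul_of_fiber hπ fun c => ?_
  rcases ((window (Finset.Iic m) ⁻¹' {c}) ∩ {γ : ℕ → S | γ m = z}).eq_empty_or_nonempty with
    h0 | ⟨x, rfl, hxz⟩
  · have : {w : (ℕ → S) × (ℕ → S) | w.1 m = z ∧ w.2 n = z} ∩
        (fun w => window (Finset.Iic m) w.1) ⁻¹' {c} = ∅ := by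
      refine eq_empty_of_forall_notMem ?_
      rintro w ⟨h1, h2⟩
      exact eq_empty_iff_forall_notMem.1 h0 w.1 ⟨h2, h1.1⟩
    simp [this]
  set A := window (Finset.Iic m) ⁻¹' {window (Finset.Iic m) x} ∩ {γ : ℕ → S | γ m = z} with hA
  set B := window (Finset.Iic n) ⁻¹' univ ∩ {γ : ℕ → S | γ n = z} with hB
  set v := finiteErasure m x with hv
  set D := {w : (ℕ → S) × (ℕ → S) | MeetsNoLater v w.1 w.2} with hD
  have hDm : MeasurableSet D := measurableSet_meetsNoLater (fun i => measurable_const)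
    (fun _ => measurable_fst_coord _) (fun _ => measurable_snd_coord _)
  have e1 : {w : (ℕ → S) × (ℕ → S) | w.1 m = z ∧ w.2 n = z} ∩
      (fun w => window (Finset.Iic m) w.1) ⁻¹' {window (Finset.Iic m) x} = A ×ˢ B := by
    ext w
    simp only [hA, hB, mem_inter_iff, mem_preimage, mem_singleton_iff, mem_ofPred_eq, mem_prod,
      mem_univ, true_and]
    tauto
  have e2 : A ×ˢ B ∩ Prod.map (shift m) (shift n) ⁻¹' D
      ⊆ {w | w.1 m = z ∧ w.2 n = z} ∩ goodSet m n ∩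
        (fun w => window (Finset.Iic m) w.1) ⁻¹' {window (Finset.Iic m) x} := by
    rintro w ⟨⟨⟨h1, h2⟩, -, h3⟩, h4⟩
    refine ⟨⟨⟨h2, h3⟩, h2.trans h3.symm, ?_⟩, h1⟩
    have : finiteErasure m w.1 = v := funext fun j => finiteErasure_congr (fun i hi =>
      window_eq_window_iff.1 (show window (Finset.Iic m) w.1 = window (Finset.Iic m) x from h1) i
        (by simpa using hi)) j
    rw [this]
    exact h4
  have hα : ((P.restrict A).map (shift m)) univ = P A := by
    rw [Measure.map_apply (measurable_shift m) MeasurableSet.univ]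
    simp
  have hβ : ((Q.restrict B).map (shift n)) univ = Q B := by
    rw [Measure.map_apply (measurable_shift n) MeasurableSet.univ]
    simp
  have hβz : ((Q.restrict B).map (shift n)) {s | s 0 = v m} = Q B := by
    rw [Measure.map_apply (measurable_shift n) (measurableSet_coord_eq 0 _),
      Measure.restrict_apply (measurable_shift n (measurableSet_coord_eq 0 _)), hv,
      finiteErasure_self]
    congr 1
    refine inter_eq_right.2 fun γ hγ => ?_
    exact hγ.2.trans hxz.symm
  have key := measure_univ_mul_le_two_mul_meetsNoLater
    (α := (P.restrict A).map (shift m)) (β := (Q.restrict B).map (shift n)) (v := v) (j := m)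
    (by rw [hα, hβ]; exact hP.smul_map_shift_eq hQ hm hn _ _ z) (by rw [hβ, hβz])
  rw [hα, hβ, Measure.map_prod_map _ _ (measurable_shift m) (measurable_shift n),
    Measure.map_apply ((measurable_shift m).prodMap (measurable_shift n)) hDm,
    Measure.prod_restrict, Measure.restrict_apply
      (((measurable_shift m).prodMap (measurable_shift n)) hDm), inter_comm] at key
  rw [e1, Measure.prod_prod]
  exact key.trans (mul_le_mul' le_rfl (measure_mono e2))

end FiniteErasure

/-! ### The second moment of the weighted number of intersections -/

section SecondMoment

variable {S : Type*} [MeasurableSpace S] [Countable S] [DiscreteMeasurableSpace S]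

theorem condAvg_eq_zero {α C : Type*} [MeasurableSpace α] [MeasurableSpace C]
    [DiscreteMeasurableSpace C] {μ : Measure α} {π : α → C} (hπ : Measurable π) {f : α → ℝ≥0∞}
    {x : α} (h : ∀ x', π x' = π x → f x' = 0) : condAvg μ π f x = 0 := by
  rw [condAvg, setLAverage_eq,
    setLIntegral_congr_fun (hπ (measurableSet_singleton _)) (fun x' hx' => h x' hx')]
  simp

theorem measurable_condAvg_snd {α β : Type*} [MeasurableSpace α] [MeasurableSpace β]
    {ν : Measure β} [SFinite ν] {π : β → S} (hπ : Measurable π) {f : α × β → ℝ≥0∞}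
    (hf : Measurable f) : Measurable fun w : α × β => condAvg ν π (fun b => f (w.1, b)) w.2 := by
  have hF : Measurable fun u : α × S => (∫⁻ b in π ⁻¹' {u.2}, f (u.1, b) ∂ν) / ν (π ⁻¹' {u.2}) :=
    measurable_from_prod_countable_left fun c =>
      (hf.lintegral_prod_right' (ν := ν.restrict (π ⁻¹' {c}))).div_const (ν (π ⁻¹' {c}))
  have hpair : Measurable fun w : α × β => (w.1, π w.2) :=
    measurable_fst.prodMk (hπ.comp measurable_snd)
  have := hF.comp hpair
  simp only [Function.comp_def] at this
  simpa only [condAvg, setLAverage_eq] using this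

theorem measurable_condAvg_fst {α β : Type*} [MeasurableSpace α] [MeasurableSpace β]
    {μ : Measure α} [SFinite μ] {π : α → S} (hπ : Measurable π) {f : α × β → ℝ≥0∞}
    (hf : Measurable f) : Measurable fun w : α × β => condAvg μ π (fun a => f (a, w.2)) w.1 := by
  have hf' : Measurable fun w : β × α => f (w.2, w.1) := hf.comp measurable_swap
  have h1 : Measurable fun w : β × α => condAvg μ π (fun a => f (a, w.1)) w.2 :=
    measurable_condAvg_snd hπ hf'
  have := h1.comp (measurable_swap (α := α) (β := β))
  simpa only [Function.comp_def, Prod.fst_swap, Prod.snd_swap] using this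

/-- For a function `h` of two independent paths, with laws `P` and `Q`, the conditional expectation
of `h` given the state of the first path at time `m` and of the second one at time `n`. -/
noncomputable def pairAvg (P Q : Measure (ℕ → S)) (m n : ℕ) (h : (ℕ → S) × (ℕ → S) → ℝ≥0∞)
    (w : (ℕ → S) × (ℕ → S)) : ℝ≥0∞ :=
  condAvg P (fun γ => γ m) (fun x => condAvg Q (fun γ => γ n) (fun y => h (x, y)) w.2) w.1

variable {p : S → PMF S} {k : ℕ} {P Q : Measure (ℕ → S)} [IsFiniteMeasure P] [IsFiniteMeasure Q]

theorem measurable_pairAvg {m n : ℕ} {h : (ℕ → S) × (ℕ → S) → ℝ≥0∞} (hh : Measurable h) :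
    Measurable (pairAvg P Q m n h) :=
  measurable_condAvg_fst (measurable_pi_apply m) (measurable_condAvg_snd (measurable_pi_apply n) hh)

theorem lintegral_pairAvg {m n : ℕ} {h : (ℕ → S) × (ℕ → S) → ℝ≥0∞} (hh : Measurable h) :
    ∫⁻ w, pairAvg P Q m n h w ∂(P.prod Q) = ∫⁻ w, h w ∂(P.prod Q) := by
  have hg : Measurable fun w : (ℕ → S) × (ℕ → S) =>
      condAvg Q (fun γ => γ n) (fun y => h (w.1, y)) w.2 :=
    measurable_condAvg_snd (measurable_pi_apply n) hh
  calc ∫⁻ w, pairAvg P Q m n h w ∂(P.prod Q)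
      = ∫⁻ y, ∫⁻ x, pairAvg P Q m n h (x, y) ∂P ∂Q :=
        lintegral_prod_symm _ (measurable_pairAvg hh).aemeasurable
    _ = ∫⁻ y, ∫⁻ x, condAvg Q (fun γ => γ n) (fun y' => h (x, y')) y ∂P ∂Q :=
        lintegral_congr fun y => lintegral_condAvg (measurable_pi_apply m)
          (hg.comp (measurable_id.prodMk measurable_const))
    _ = ∫⁻ x, ∫⁻ y, condAvg Q (fun γ => γ n) (fun y' => h (x, y')) y ∂Q ∂P := by
        rw [← lintegral_prod_symm _ hg.aemeasurable, lintegral_prod _ hg.aemeasurable]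
    _ = ∫⁻ x, ∫⁻ y, h (x, y) ∂Q ∂P :=
        lintegral_congr fun x => lintegral_condAvg (measurable_pi_apply n)
          (hh.comp (measurable_const.prodMk measurable_id))
    _ = ∫⁻ w, h w ∂(P.prod Q) := (lintegral_prod _ hh.aemeasurable).symm

/-- The two-parameter version of the dual maximal inequality, obtained by applying the
one-parameter inequality in each of the two paths. -/
theorem IsMarkovFrom.lintegral_sum_pairAvg_sq_le (hP : IsMarkovFrom p k P)
    (hQ : IsMarkovFrom p k Q) {M : ℕ} {I : Finset ℕ} (hI : ∀ n ∈ I, k ≤ n ∧ n ≤ M)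
    {h : ℕ → ℕ → (ℕ → S) × (ℕ → S) → ℝ≥0∞} (hh : ∀ m n, Measurable (h m n)) {K : ℝ≥0∞}
    (hK : K ≠ ∞) (hhK : ∀ m n w, h m n w ≤ K) :
    ∫⁻ w, (∑ m ∈ I, ∑ n ∈ I, pairAvg P Q m n (h m n) w) ^ 2 ∂(P.prod Q)
      ≤ 256 * ∫⁻ w, (∑ m ∈ I, ∑ n ∈ I, h m n w) ^ 2 ∂(P.prod Q) := by
  set g : ℕ → ℕ → (ℕ → S) × (ℕ → S) → ℝ≥0∞ := fun m n w =>
    condAvg Q (fun γ => γ n) (fun y => h m n (w.1, y)) w.2 with hg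
  have hgm : ∀ m n, Measurable (g m n) := fun m n =>
    measurable_condAvg_snd (measurable_pi_apply n) (hh m n)
  have hgK : ∀ m n w, g m n w ≤ K := fun m n w => condAvg_le (fun y => hhK m n (w.1, y)) _
  have hWm : ∀ m n, Measurable (pairAvg P Q m n (h m n)) := fun m n => measurable_pairAvg (hh m n)
  have hcK : (I.card : ℝ≥0∞) * K ≠ ∞ := ENNReal.mul_ne_top (by simp) hK
  have hgx : ∀ m n y, Measurable fun x => g m n (x, y) := fun m n y =>
    (hgm m n).comp (measurable_id.prodMk measurable_const)
  have hhy : ∀ m n x, Measurable fun y => h m n (x, y) := fun m n x =>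
    (hh m n).comp (measurable_const.prodMk measurable_id)
  have step1 : ∀ y, ∫⁻ x, (∑ m ∈ I, ∑ n ∈ I, pairAvg P Q m n (h m n) (x, y)) ^ 2 ∂P
      ≤ 16 * ∫⁻ x, (∑ m ∈ I, ∑ n ∈ I, g m n (x, y)) ^ 2 ∂P := by
    intro y
    refine le_trans (le_of_eq ?_) (hP.lintegral_sum_condAvg_coord_sq_le hI
      (h := fun m x => ∑ n ∈ I, g m n (x, y))
      (fun m => Finset.measurable_fun_sum _ fun n _ => hgx m n y) hcK
      (fun m x => (Finset.sum_le_sum fun n _ => hgK m n (x, y)).trans_eq (by simp)))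
    refine lintegral_congr fun x => ?_
    congr 1
    refine Finset.sum_congr rfl fun m _ => ?_
    rw [condAvg_finsetSum I _ fun n _ => hgx m n y]
    rfl
  have step2 : ∀ x, ∫⁻ y, (∑ m ∈ I, ∑ n ∈ I, g m n (x, y)) ^ 2 ∂Q
      ≤ 16 * ∫⁻ y, (∑ m ∈ I, ∑ n ∈ I, h m n (x, y)) ^ 2 ∂Q := by
    intro x
    have := hQ.lintegral_sum_condAvg_coord_sq_le hI
      (h := fun n y => ∑ m ∈ I, h m n (x, y))
      (fun n => Finset.measurable_fun_sum _ fun m _ => hhy m n x) hcK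
      (fun n y => (Finset.sum_le_sum fun m _ => hhK m n (x, y)).trans_eq (by simp))
    simp only [Finset.sum_comm (s := I) (t := I) (f := fun m n => h m n (x, _))]
    refine le_trans (le_of_eq ?_) this
    refine lintegral_congr fun y => ?_
    congr 1
    rw [Finset.sum_comm]
    refine Finset.sum_congr rfl fun n _ => ?_
    rw [condAvg_finsetSum I _ fun m _ => hhy m n x]
  have m1 : Measurable fun w => (∑ m ∈ I, ∑ n ∈ I, pairAvg P Q m n (h m n) w) ^ 2 := by fun_prop
  have m2 : Measurable fun w => (∑ m ∈ I, ∑ n ∈ I, g m n w) ^ 2 := by fun_prop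
  have m3 : Measurable fun w => (∑ m ∈ I, ∑ n ∈ I, h m n w) ^ 2 := by fun_prop
  rw [lintegral_prod_symm _ m1.aemeasurable]
  calc _ ≤ ∫⁻ y, 16 * ∫⁻ x, (∑ m ∈ I, ∑ n ∈ I, g m n (x, y)) ^ 2 ∂P ∂Q :=
        lintegral_mono step1
    _ = 16 * ∫⁻ x, ∫⁻ y, (∑ m ∈ I, ∑ n ∈ I, g m n (x, y)) ^ 2 ∂Q ∂P := by
        rw [lintegral_const_mul' _ _ (by simp), ← lintegral_prod_symm _ m2.aemeasurable,
          lintegral_prod _ m2.aemeasurable]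
    _ ≤ 16 * ∫⁻ x, 16 * ∫⁻ y, (∑ m ∈ I, ∑ n ∈ I, h m n (x, y)) ^ 2 ∂Q ∂P := by
        gcongr with x
        exact step2 x
    _ = _ := by
        rw [lintegral_const_mul' _ _ (by simp), ← lintegral_prod _ m3.aemeasurable, ← mul_assoc]
        norm_num

/-- If `h` lives on the pairs of paths that meet at times `m` and `n`, at least half of the mass of
its conditional expectation lies on the good event. -/
theorem IsMarkovFrom.lintegral_pairAvg_le_two_mul_good (hP : IsMarkovFrom p k P)
    (hQ : IsMarkovFrom p k Q) {m n : ℕ} (hm : k ≤ m) (hn : k ≤ n)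
    {h : (ℕ → S) × (ℕ → S) → ℝ≥0∞} (hsupp : ∀ w, w.1 m ≠ w.2 n → h w = 0) :
    ∫⁻ w, pairAvg P Q m n h w ∂(P.prod Q)
      ≤ 2 * ∫⁻ w in goodSet m n, pairAvg P Q m n h w ∂(P.prod Q) := by
  have hφ : Measurable fun w : (ℕ → S) × (ℕ → S) => (w.1 m, w.2 n) :=
    (measurable_fst_coord m).prodMk (measurable_snd_coord n)
  rw [lintegral_eq_tsum_fiber _ hφ, lintegral_eq_tsum_fiber _ hφ, ← ENNReal.tsum_mul_left]
  refine ENNReal.tsum_le_tsum fun c => ?_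
  have hFm := hφ (measurableSet_singleton c)
  set F := (fun w : (ℕ → S) × (ℕ → S) => (w.1 m, w.2 n)) ⁻¹' {c} with hF
  rcases F.eq_empty_or_nonempty with h0 | ⟨w₀, hw₀⟩
  · simp [h0]
  have hconst : ∀ w ∈ F, pairAvg P Q m n h w = pairAvg P Q m n h w₀ := by
    intro w hw
    have hww : (w.1 m, w.2 n) = (w₀.1 m, w₀.2 n) := Eq.trans hw (Eq.symm hw₀)
    rw [Prod.mk.injEq] at hww
    rw [pairAvg, condAvg_congr_fiber hww.1, pairAvg]
    congr 1
    ext x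
    exact condAvg_congr_fiber hww.2
  rw [setLIntegral_congr_fun hFm hconst, setLIntegral_congr_fun hFm hconst, setLIntegral_const,
    setLIntegral_const, Measure.restrict_apply hFm, mul_left_comm]
  by_cases hc : w₀.1 m = w₀.2 n
  · gcongr
    have hFz : F = {w | w.1 m = w₀.1 m ∧ w.2 n = w₀.1 m} := by
      have hw₀ : (w₀.1 m, w₀.2 n) = c := hw₀
      ext w
      rw [hF, ← hw₀, ← hc]
      simp
    rw [hFz]
    exact hP.measure_meet_le_two_mul_good hQ hm hn _
  · have : pairAvg P Q m n h w₀ = 0 := by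
      refine condAvg_eq_zero (measurable_pi_apply m) fun x hx => ?_
      refine condAvg_eq_zero (measurable_pi_apply n) fun y hy => hsupp _ ?_
      change x m ≠ y n
      rwa [hx, hy]
    simp [this]

/-- The coefficient of `a ^ 2` is `1 / (4 * 256)`: multiplied by the bound `256` of the second
moment, it leaves only a quarter of the first moment. -/
theorem le_sq_div_add (a : ℝ≥0∞) : a ≤ 1024⁻¹ * a ^ 2 + 256 := by
  rcases eq_or_ne a ∞ with rfl | ha
  · simp [ENNReal.mul_top]
  lift a to NNReal using ha
  have h2 : (1024⁻¹ : ℝ≥0∞) = ((1024⁻¹ : NNReal) : ℝ≥0∞) := by simp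
  rw [h2]
  norm_cast
  rw [← NNReal.coe_le_coe]
  push_cast
  nlinarith [sq_nonneg ((a : ℝ) - 512)]

open Classical in
/-- The probability that two independent chains meet during a time window is at most a constant
times the probability that they do so on a good event. This is the second moment method, applied
to the sum over `m`, `n` of the conditional expectations, given the states at times `m` and `n`, of
the events that the paths meet at these times, each normalized by the number of meetings. The
normalization makes the sum before conditioning the indicator of a meeting. -/
theorem IsMarkovFrom.measure_meet_le_goodSet (hP : IsMarkovFrom p k P) (hQ : IsMarkovFrom p k Q)
    {M : ℕ} {I : Finset ℕ} (hI : ∀ n ∈ I, k ≤ n ∧ n ≤ M) :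
    (P.prod Q) {w | ∃ m ∈ I, ∃ n ∈ I, w.1 m = w.2 n}
      ≤ 1024 * (P.prod Q) (⋃ m ∈ I, ⋃ n ∈ I, goodSet m n) := by
  set H := {w : (ℕ → S) × (ℕ → S) | ∃ m ∈ I, ∃ n ∈ I, w.1 m = w.2 n} with hH
  set G := ⋃ m ∈ I, ⋃ n ∈ I, goodSet (S := S) m n with hG
  set e : ℕ → ℕ → (ℕ → S) × (ℕ → S) → ℝ≥0∞ := fun m n =>
    {w | w.1 m = w.2 n}.indicator 1 with he
  set N : (ℕ → S) × (ℕ → S) → ℝ≥0∞ := fun w => ∑ m ∈ I, ∑ n ∈ I, e m n w with hN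
  set h : ℕ → ℕ → (ℕ → S) × (ℕ → S) → ℝ≥0∞ := fun m n w =>
    if m ∈ I ∧ n ∈ I then e m n w * (N w)⁻¹ else 0 with hh
  have hem : ∀ m n, Measurable (e m n) := fun m n => measurable_one.indicator
    (measurableSet_eq_fun (measurable_fst_coord m) (measurable_snd_coord n))
  have hNm : Measurable N := by fun_prop
  have hhm : ∀ m n, Measurable (h m n) := by
    intro m n
    by_cases hmn : m ∈ I ∧ n ∈ I
    · simp only [hh, hmn, and_self, if_true]
      fun_prop
    · simp only [hh, hmn, if_false]
      fun_prop
  have hNtop : ∀ w, N w ≠ ∞ := fun w => ENNReal.sum_ne_top.2 fun m _ =>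
    ENNReal.sum_ne_top.2 fun n _ => by
      simp only [he, indicator]
      split_ifs <;> simp
  have hsupp : ∀ m n w, w.1 m ≠ w.2 n → h m n w = 0 := by
    intro m n w hw
    simp [hh, he, hw]
  have hsum : ∀ w, ∑ m ∈ I, ∑ n ∈ I, h m n w = H.indicator 1 w := by
    intro w
    have e1 : ∑ m ∈ I, ∑ n ∈ I, h m n w = N w * (N w)⁻¹ := by
      simp only [hN, Finset.sum_mul]
      exact Finset.sum_congr rfl fun m hm => Finset.sum_congr rfl fun n hn => if_pos ⟨hm, hn⟩
    rw [e1]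
    by_cases hw : w ∈ H
    · obtain ⟨m, hm, n, hn, hmn⟩ := hw
      have hw : w ∈ H := ⟨m, hm, n, hn, hmn⟩
      have h0 : N w ≠ 0 := by
        intro h0
        rw [hN, Finset.sum_eq_zero_iff] at h0
        have := Finset.sum_eq_zero_iff.1 (h0 m hm) n hn
        simp [he, hmn] at this
      simp [hw, ENNReal.mul_inv_cancel h0 (hNtop w)]
    · have h0 : N w = 0 := Finset.sum_eq_zero fun m hm => Finset.sum_eq_zero fun n hn =>
        by
          have hmn : w.1 m ≠ w.2 n := fun hmn => hw ⟨m, hm, n, hn, hmn⟩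
          simp [he, hmn]
      simp [hw, h0]
  have hle1 : ∀ m n w, h m n w ≤ 1 := by
    intro m n w
    by_cases hmn : m ∈ I ∧ n ∈ I
    · calc h m n w ≤ ∑ n ∈ I, h m n w :=
            Finset.single_le_sum (f := fun n => h m n w) (fun _ _ => zero_le) hmn.2
        _ ≤ ∑ m ∈ I, ∑ n ∈ I, h m n w :=
            Finset.single_le_sum (f := fun m => ∑ n ∈ I, h m n w) (fun _ _ => zero_le) hmn.1
        _ ≤ 1 := by rw [hsum]; exact indicator_le_self' (by simp) w
    · simp [hh, hmn]
  have hHm : MeasurableSet H := by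
    have : H = ⋃ m ∈ I, ⋃ n ∈ I, {w | w.1 m = w.2 n} := by ext w; simp [hH]
    rw [this]
    exact Finset.measurableSet_biUnion _ fun m _ => Finset.measurableSet_biUnion _ fun n _ =>
      measurableSet_eq_fun (measurable_fst_coord m) (measurable_snd_coord n)
  have hGm : MeasurableSet G := Finset.measurableSet_biUnion _ fun m _ =>
    Finset.measurableSet_biUnion _ fun n _ => measurableSet_goodSet m n
  set T : (ℕ → S) × (ℕ → S) → ℝ≥0∞ := fun w => ∑ m ∈ I, ∑ n ∈ I, pairAvg P Q m n (h m n) w with hT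
  have hWm : ∀ m n, Measurable (pairAvg P Q m n (h m n)) := fun m n => measurable_pairAvg (hhm m n)
  have hTm : Measurable T := by fun_prop
  have hT2 : ∫⁻ w, T w ^ 2 ∂(P.prod Q) ≤ 256 * (P.prod Q) H := by
    refine (hP.lintegral_sum_pairAvg_sq_le hQ hI hhm ENNReal.one_ne_top hle1).trans_eq ?_
    rw [← lintegral_indicator_one hHm]
    congr 1
    refine lintegral_congr fun w => ?_
    rw [hsum]
    by_cases hw : w ∈ H <;> simp [hw]
  have hsumint : ∀ (ν : Measure ((ℕ → S) × (ℕ → S))) (f : ℕ → ℕ → (ℕ → S) × (ℕ → S) → ℝ≥0∞),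
      (∀ m n, Measurable (f m n)) → ∫⁻ w, ∑ m ∈ I, ∑ n ∈ I, f m n w ∂ν
        = ∑ m ∈ I, ∑ n ∈ I, ∫⁻ w, f m n w ∂ν := by
    intro ν f hf
    rw [lintegral_finsetSum _ (by fun_prop)]
    exact Finset.sum_congr rfl fun m _ => lintegral_finsetSum _ (by fun_prop)
  have hmean : (P.prod Q) H = ∫⁻ w, T w ∂(P.prod Q) := by
    rw [← lintegral_indicator_one hHm, ← lintegral_congr hsum, hsumint _ _ hhm, hT,
      hsumint _ _ hWm]
    exact Finset.sum_congr rfl fun m _ => Finset.sum_congr rfl fun n _ =>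
      (lintegral_pairAvg (hhm m n)).symm
  have hhalf : ∫⁻ w, T w ∂(P.prod Q) ≤ 2 * ∫⁻ w in G, T w ∂(P.prod Q) := by
    rw [hT, hsumint _ _ hWm, hsumint _ _ hWm, Finset.mul_sum]
    refine Finset.sum_le_sum fun m hm => ?_
    rw [Finset.mul_sum]
    refine Finset.sum_le_sum fun n hn => ?_
    refine (hP.lintegral_pairAvg_le_two_mul_good hQ (hI m hm).1 (hI n hn).1 (hsupp m n)).trans ?_
    gcongr
    exact (subset_biUnion_of_mem (u := fun n => goodSet m n) hn).trans
      (subset_biUnion_of_mem (u := fun m => ⋃ n ∈ I, goodSet m n) hm)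
  have hGT : ∫⁻ w in G, T w ∂(P.prod Q) ≤ 4⁻¹ * (P.prod Q) H + 256 * (P.prod Q) G := by
    calc ∫⁻ w in G, T w ∂(P.prod Q)
        ≤ ∫⁻ w in G, (1024⁻¹ * T w ^ 2 + 256) ∂(P.prod Q) :=
          lintegral_mono fun w => le_sq_div_add _
      _ = 1024⁻¹ * ∫⁻ w in G, T w ^ 2 ∂(P.prod Q) + 256 * (P.prod Q) G := by
          rw [lintegral_add_right _ measurable_const, lintegral_const_mul _ (by fun_prop),
            setLIntegral_const]
      _ ≤ 1024⁻¹ * (256 * (P.prod Q) H) + 256 * (P.prod Q) G := by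
          gcongr
          exact (setLIntegral_le_lintegral _ _).trans hT2
      _ = 4⁻¹ * (P.prod Q) H + 256 * (P.prod Q) G := by
          rw [← mul_assoc]
          congr 2
          rw [show (1024 : ℝ≥0∞) = 4 * 256 by norm_num,
            ENNReal.mul_inv (by simp) (by simp), mul_assoc,
            ENNReal.inv_mul_cancel (by simp) (by simp), mul_one]
  have hfin : (P.prod Q) H ≠ ∞ := measure_ne_top _ _
  have hmain : 2⁻¹ * (P.prod Q) H + 2⁻¹ * (P.prod Q) H
      ≤ 2⁻¹ * (P.prod Q) H + 512 * (P.prod Q) G := by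
    calc 2⁻¹ * (P.prod Q) H + 2⁻¹ * (P.prod Q) H = (P.prod Q) H := by
          rw [← add_mul, ENNReal.inv_two_add_inv_two, one_mul]
      _ ≤ 2 * (4⁻¹ * (P.prod Q) H + 256 * (P.prod Q) G) :=
          (hmean.trans_le hhalf).trans (mul_le_mul' le_rfl hGT)
      _ = 2⁻¹ * (P.prod Q) H + 512 * (P.prod Q) G := by
          rw [mul_add, ← mul_assoc, ← mul_assoc]
          congr 2
          · rw [show (4 : ℝ≥0∞) = 2 * 2 by norm_num, ENNReal.mul_inv (by simp) (by simp),
              ← mul_assoc, ENNReal.mul_inv_cancel (by simp) (by simp), one_mul]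
          · norm_num
  have hlast := (ENNReal.add_le_add_iff_left (ENNReal.mul_ne_top (by simp) hfin)).1 hmain
  calc (P.prod Q) H = 2 * (2⁻¹ * (P.prod Q) H) := by
        rw [← mul_assoc, ENNReal.mul_inv_cancel (by simp) (by simp), one_mul]
    _ ≤ 2 * (512 * (P.prod Q) G) := by gcongr
    _ = 1024 * (P.prod Q) G := by rw [← mul_assoc]; norm_num

end SecondMoment

/-! ### From positive probability to almost sure statements -/

section Localization

variable {S : Type*}

/-- The pairs of paths that meet at some times `m, n ≥ N`. -/
def meetFrom (N : ℕ) : Set ((ℕ → S) × (ℕ → S)) :=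
  {w | ∃ m, N ≤ m ∧ ∃ n, N ≤ n ∧ w.1 m = w.2 n}

/-- The pairs of paths for which the good event occurs at some times `m, n ≥ N`. -/
def goodFrom (N : ℕ) : Set ((ℕ → S) × (ℕ → S)) :=
  {w | ∃ m, N ≤ m ∧ ∃ n, N ≤ n ∧ w ∈ goodSet m n}

theorem goodFrom_antitone : Antitone (goodFrom (S := S)) :=
  fun _ _ hN _ ⟨m, hm, n, hn, h⟩ => ⟨m, hN.trans hm, n, hN.trans hn, h⟩

/-- Only finitely many of the common states can be visited before time `N`. -/
theorem mem_meetFrom_of_infinite {x y : ℕ → S} (h : (range x ∩ range y).Infinite) (N : ℕ) :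
    (x, y) ∈ meetFrom N := by
  have hfin : (x '' Iio N ∪ y '' Iio N).Finite :=
    ((finite_Iio N).image x).union ((finite_Iio N).image y)
  obtain ⟨v, ⟨⟨m, hm⟩, n, hn⟩, hv⟩ := (h.sdiff hfin).nonempty
  refine ⟨m, ?_, n, ?_, hm.trans hn.symm⟩
  · by_contra hmN
    exact hv (Or.inl ⟨m, not_le.1 hmN, hm⟩)
  · by_contra hnN
    exact hv (Or.inr ⟨n, not_le.1 hnN, hn⟩)

theorem infinite_of_mem_goodFrom {x y : ℕ → S} (hy : ∀ v, {n | y n = v}.Finite)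
    (h : ∀ N, (x, y) ∈ goodFrom N) : (range (loopErasure x) ∩ range y).Infinite := by
  intro hfin
  obtain ⟨b, hb⟩ := (hfin.biUnion fun v _ => hy v).bddAbove
  obtain ⟨m, -, n, hn, hg⟩ := h (b + 1)
  obtain ⟨i, hi, hiy⟩ := exists_mem_range_loopErasure hg
  have := hb (mem_biUnion (⟨hiy, i, rfl⟩ : y i ∈ range (loopErasure x) ∩ range y) rfl)
  omega

variable [MeasurableSpace S]

/-- The parts of two paths up to time `l`. -/
def pairPast (l : ℕ) (w : (ℕ → S) × (ℕ → S)) : (Finset.Iic l → S) × (Finset.Iic l → S) :=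
  (window (Finset.Iic l) w.1, window (Finset.Iic l) w.2)

theorem measurable_pairPast (l : ℕ) : Measurable (pairPast (S := S) l) :=
  ((measurable_window _).comp measurable_fst).prodMk ((measurable_window _).comp measurable_snd)

variable [Countable S] [DiscreteMeasurableSpace S]

theorem measurableSet_meetFrom (N : ℕ) : MeasurableSet (meetFrom (S := S) N) := by
  have : meetFrom (S := S) N = ⋃ m, ⋃ (_ : N ≤ m), ⋃ n, ⋃ (_ : N ≤ n), {w | w.1 m = w.2 n} := by
    ext w; simp [meetFrom]
  rw [this]
  exact .iUnion fun m => .iUnion fun _ => .iUnion fun n => .iUnion fun _ =>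
    measurableSet_eq_fun (measurable_fst_coord m) (measurable_snd_coord n)

theorem measurableSet_goodFrom (N : ℕ) : MeasurableSet (goodFrom (S := S) N) := by
  have : goodFrom (S := S) N = ⋃ m, ⋃ (_ : N ≤ m), ⋃ n, ⋃ (_ : N ≤ n), goodSet m n := by
    ext w; simp [goodFrom]
  rw [this]
  exact .iUnion fun m => .iUnion fun _ => .iUnion fun n => .iUnion fun _ =>
    measurableSet_goodSet m n

variable {p : S → PMF S} {k : ℕ} {P Q : Measure (ℕ → S)}

theorem IsMarkovFrom.measure_meetFrom_le [IsFiniteMeasure P] [IsFiniteMeasure Q]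
    (hP : IsMarkovFrom p k P) (hQ : IsMarkovFrom p k Q) {N : ℕ} (hN : k ≤ N) :
    (P.prod Q) (meetFrom N) ≤ 1024 * (P.prod Q) (goodFrom N) := by
  have hU : meetFrom (S := S) N = ⋃ M, {w : (ℕ → S) × (ℕ → S) |
      ∃ m ∈ Finset.Icc N M, ∃ n ∈ Finset.Icc N M, w.1 m = w.2 n} := by
    ext w
    simp only [meetFrom, mem_ofPred_eq, mem_iUnion, Finset.mem_Icc]
    constructor
    · rintro ⟨m, hm, n, hn, h⟩
      exact ⟨max m n, m, ⟨hm, le_max_left _ _⟩, n, ⟨hn, le_max_right _ _⟩, h⟩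
    · rintro ⟨M, m, hm, n, hn, h⟩
      exact ⟨m, hm.1, n, hn.1, h⟩
  have hmono : Monotone fun M => {w : (ℕ → S) × (ℕ → S) |
      ∃ m ∈ Finset.Icc N M, ∃ n ∈ Finset.Icc N M, w.1 m = w.2 n} := by
    rintro M M' hM w ⟨m, hm, n, hn, h⟩
    exact ⟨m, Finset.Icc_subset_Icc_right hM hm, n, Finset.Icc_subset_Icc_right hM hn, h⟩
  rw [hU, hmono.measure_iUnion]
  refine iSup_le fun M => (hP.measure_meet_le_goodSet hQ (M := M) (I := Finset.Icc N M)
    fun n hn => ?_).trans ?_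
  · rw [Finset.mem_Icc] at hn
    exact ⟨hN.trans hn.1, hn.2⟩
  · gcongr
    simp only [iUnion_subset_iff, Finset.mem_Icc]
    exact fun m hm n hn w hw => ⟨m, hm.1, n, hn.1, hw⟩

theorem IsMarkovFrom.measure_iInter_meetFrom_le [IsFiniteMeasure P] [IsFiniteMeasure Q]
    (hP : IsMarkovFrom p k P) (hQ : IsMarkovFrom p k Q) :
    (P.prod Q) (⋂ N, meetFrom N) ≤ 1024 * (P.prod Q) (⋂ N, goodFrom N) := by
  rw [goodFrom_antitone.measure_iInter
    (fun N => (measurableSet_goodFrom N).nullMeasurableSet) ⟨0, measure_ne_top _ _⟩,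
    ENNReal.mul_iInf_of_ne (by simp) (by simp)]
  refine le_iInf fun N => ?_
  calc (P.prod Q) (⋂ N, meetFrom N) ≤ (P.prod Q) (meetFrom (max k N)) :=
        measure_mono (iInter_subset _ _)
    _ ≤ 1024 * (P.prod Q) (goodFrom (max k N)) := hP.measure_meetFrom_le hQ (le_max_left _ _)
    _ ≤ 1024 * (P.prod Q) (goodFrom N) := by
        gcongr
        exact goodFrom_antitone (le_max_right _ _)

theorem IsMarkovFrom.restrict_cylinder (hP : IsMarkovFrom p k P) {l : ℕ} (hkl : k ≤ l)
    (t : ℕ → S) : IsMarkovFrom p l (P.restrict {γ | ∀ i ≤ l, γ i = t i}) := by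
  intro n hn s
  have hm := measurableSet_forall_le_coord_eq l t
  rw [Measure.restrict_apply' hm, Measure.restrict_apply' hm]
  by_cases h : ∀ i ≤ l, s i = t i
  · have hsub : ∀ M, l ≤ M → {γ : ℕ → S | ∀ i ≤ M, γ i = s i} ∩ {γ | ∀ i ≤ l, γ i = t i}
        = {γ : ℕ → S | ∀ i ≤ M, γ i = s i} := fun M hM =>
      inter_eq_left.2 fun γ hγ i hi => (hγ i (hi.trans hM)).trans (h i hi)
    rw [hsub _ hn, hsub _ (hn.trans (Nat.le_succ n)), hP n (hkl.trans hn)]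
  · have hempty : ∀ M, l ≤ M → {γ : ℕ → S | ∀ i ≤ M, γ i = s i} ∩ {γ | ∀ i ≤ l, γ i = t i}
        = ∅ := fun M hM => eq_empty_of_forall_notMem fun γ hγ =>
      h fun i hi => (hγ.1 i (hi.trans hM)).symm.trans (hγ.2 i hi)
    rw [hempty _ hn, hempty _ (hn.trans (Nat.le_succ n))]
    simp

/-- The comparison of probabilities persists on every event that depends on finitely many steps
only, as conditioning on such steps keeps the chains Markov from some time on. -/
theorem IsMarkovFrom.measure_iInter_meetFrom_inter_le [IsFiniteMeasure P] [IsFiniteMeasure Q]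
    (hP : IsMarkovFrom p 0 P) (hQ : IsMarkovFrom p 0 Q) (l : ℕ)
    (B : Set ((Finset.Iic l → S) × (Finset.Iic l → S))) :
    (P.prod Q) ((⋂ N, meetFrom N) ∩ pairPast l ⁻¹' B)
      ≤ 1024 * (P.prod Q) ((⋂ N, goodFrom N) ∩ pairPast l ⁻¹' B) := by
  refine measure_le_mul_of_fiber (measurable_pairPast l) fun c => ?_
  by_cases hc : c ∈ B ∧ (pairPast l ⁻¹' {c}).Nonempty
  swap
  · have : (⋂ N, meetFrom N) ∩ pairPast l ⁻¹' B ∩ pairPast l ⁻¹' {c} = ∅ := by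
      refine eq_empty_of_forall_notMem ?_
      rintro w ⟨⟨-, h1⟩, h2⟩
      have h2' : pairPast l w = c := h2
      exact hc ⟨h2' ▸ h1, w, h2⟩
    simp [this]
  obtain ⟨hcB, w₀, rfl⟩ := hc
  have hfib : pairPast l ⁻¹' {pairPast l w₀}
      = {γ | ∀ i ≤ l, γ i = w₀.1 i} ×ˢ {γ | ∀ i ≤ l, γ i = w₀.2 i} := by
    ext w
    simp only [mem_preimage, mem_singleton_iff, pairPast, Prod.mk.injEq, window_eq_window_iff,
      Finset.mem_Iic, mem_prod, mem_ofPred_eq]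
  have hinter : ∀ E : Set ((ℕ → S) × (ℕ → S)), E ∩ pairPast l ⁻¹' B ∩
      pairPast l ⁻¹' {pairPast l w₀} = E ∩ pairPast l ⁻¹' {pairPast l w₀} := by
    intro E
    rw [inter_assoc]
    congr 1
    refine inter_eq_right.2 fun w hw => ?_
    have hw' : pairPast l w = pairPast l w₀ := hw
    rw [mem_preimage, hw']
    exact hcB
  have hm := (measurableSet_forall_le_coord_eq l w₀.1).prod
    (measurableSet_forall_le_coord_eq l w₀.2)
  rw [hinter, hinter, hfib, ← Measure.restrict_apply' hm, ← Measure.restrict_apply' hm,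
    ← Measure.prod_restrict]
  exact (hP.restrict_cylinder (Nat.zero_le l) w₀.1).measure_iInter_meetFrom_le
    (hQ.restrict_cylinder (Nat.zero_le l) w₀.2)

/-- Events that depend on finitely many steps of two paths approximate all events. -/
theorem exists_pairPast_symmDiff_lt {R : Measure ((ℕ → S) × (ℕ → S))} [IsFiniteMeasure R]
    {A : Set ((ℕ → S) × (ℕ → S))} (hA : MeasurableSet A) {ε : ℝ≥0∞} (hε : 0 < ε) :
    ∃ l, ∃ B, R (symmDiff (pairPast l ⁻¹' B) A) < ε := by
  set C : Set (Set ((ℕ → S) × (ℕ → S))) := {t | ∃ l B, t = pairPast l ⁻¹' B} with hC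
  have hlift : ∀ {l l'}, l ≤ l' → ∀ B, ∃ B', pairPast (S := S) l ⁻¹' B = pairPast l' ⁻¹' B' := by
    intro l l' hll B
    refine ⟨{c | ((fun i => c.1 ⟨i, ?_⟩, fun i => c.2 ⟨i, ?_⟩) :
      (Finset.Iic l → S) × (Finset.Iic l → S)) ∈ B}, rfl⟩ <;>
    exact Finset.mem_Iic.2 ((Finset.mem_Iic.1 i.2).trans hll)
  have hring : IsSetRing C := by
    refine ⟨⟨0, ∅, rfl⟩, ?_, ?_⟩
    · rintro _ _ ⟨l, B, rfl⟩ ⟨l', B', rfl⟩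
      obtain ⟨D, hD⟩ := hlift (le_max_left l l') B
      obtain ⟨D', hD'⟩ := hlift (le_max_right l l') B'
      exact ⟨max l l', D ∪ D', by rw [hD, hD']; rfl⟩
    · rintro _ _ ⟨l, B, rfl⟩ ⟨l', B', rfl⟩
      obtain ⟨D, hD⟩ := hlift (le_max_left l l') B
      obtain ⟨D', hD'⟩ := hlift (le_max_right l l') B'
      exact ⟨max l l', D \ D', by rw [hD, hD']; rfl⟩
  have hgen : (inferInstance : MeasurableSpace ((ℕ → S) × (ℕ → S)))
      = MeasurableSpace.generateFrom C := by
    refine le_antisymm ?_ (MeasurableSpace.generateFrom_le ?_)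
    · have h1 : ∀ i, Measurable[MeasurableSpace.generateFrom C]
          fun w : (ℕ → S) × (ℕ → S) => w.1 i := fun i s _ =>
        MeasurableSpace.measurableSet_generateFrom
          ⟨i, {c | c.1 ⟨i, Finset.mem_Iic.2 le_rfl⟩ ∈ s}, rfl⟩
      have h2 : ∀ i, Measurable[MeasurableSpace.generateFrom C]
          fun w : (ℕ → S) × (ℕ → S) => w.2 i := fun i s _ =>
        MeasurableSpace.measurableSet_generateFrom
          ⟨i, {c | c.2 ⟨i, Finset.mem_Iic.2 le_rfl⟩ ∈ s}, rfl⟩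
      have h3 : Measurable[MeasurableSpace.generateFrom C]
          fun w : (ℕ → S) × (ℕ → S) => (w.1, w.2) :=
        (@measurable_pi_lambda _ _ _ (MeasurableSpace.generateFrom C) _ _ h1).prodMk
          (@measurable_pi_lambda _ _ _ (MeasurableSpace.generateFrom C) _ _ h2)
      exact fun s hs => h3 hs
    · rintro _ ⟨l, B, rfl⟩
      exact measurable_pairPast l (MeasurableSet.of_discrete)
  obtain ⟨_, ⟨l, B, rfl⟩, h⟩ := exists_measure_symmDiff_lt_of_generateFrom_isSetRing (μ := R) hring
    ⟨{univ}, countable_singleton _, by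
      rw [singleton_subset_iff]; exact ⟨0, univ, rfl⟩, by simp⟩ hgen hA hε
  exact ⟨l, B, h⟩

/-- Let `E` be the event of arbitrarily late meetings and `G` that of arbitrarily late good
meetings. The bound `P(E ∩ t) ≤ 1024 P(G ∩ t)` for events `t` of finitely many steps, applied to
an approximation `t` of `E \ G`, makes `P(E \ G)` arbitrarily small. -/
theorem IsMarkovFrom.ae_mem_goodFrom [IsFiniteMeasure P] [IsFiniteMeasure Q]
    (hP : IsMarkovFrom p 0 P) (hQ : IsMarkovFrom p 0 Q) :
    ∀ᵐ w ∂(P.prod Q), (∀ N, w ∈ meetFrom N) → ∀ N, w ∈ goodFrom N := by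
  set E : Set ((ℕ → S) × (ℕ → S)) := ⋂ N, meetFrom N with hE
  set G : Set ((ℕ → S) × (ℕ → S)) := ⋂ N, goodFrom N with hG
  have hEm : MeasurableSet E := .iInter fun N => measurableSet_meetFrom N
  have hGm : MeasurableSet G := .iInter fun N => measurableSet_goodFrom N
  suffices h : (P.prod Q) (E \ G) = 0 by
    filter_upwards [measure_eq_zero_iff_ae_notMem.1 h] with w hw h1
    by_contra h2
    exact hw ⟨mem_iInter.2 h1, fun h3 => h2 (mem_iInter.1 h3)⟩
  -- `E ∩ t` is most of `E \ G`, whereas `G ∩ t` is contained in the error of approximation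
  have hbound : ∀ ε : ℝ≥0∞, 0 < ε → (P.prod Q) (E \ G) ≤ 1025 * ε := by
    intro ε hε
    obtain ⟨l, B, hB⟩ := exists_pairPast_symmDiff_lt (R := P.prod Q) (hEm.diff hGm) hε
    set t := pairPast l ⁻¹' B with ht
    calc (P.prod Q) (E \ G) ≤ (P.prod Q) (symmDiff t (E \ G) ∪ E ∩ t) := by
          refine measure_mono fun w hw => ?_
          by_cases hwt : w ∈ t
          · exact Or.inr ⟨hw.1, hwt⟩
          · exact Or.inl (Or.inr ⟨hw, hwt⟩)
      _ ≤ (P.prod Q) (symmDiff t (E \ G)) + (P.prod Q) (E ∩ t) := measure_union_le _ _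
      _ ≤ ε + 1024 * (P.prod Q) (G ∩ t) := by
          gcongr
          exact hP.measure_iInter_meetFrom_inter_le hQ l B
      _ ≤ ε + 1024 * ε := by
          gcongr
          refine (measure_mono fun w hw => ?_).trans hB.le
          exact Or.inl ⟨hw.2, fun h => h.2 hw.1⟩
      _ = 1025 * ε := by ring
  by_contra h0
  have := hbound ((P.prod Q) (E \ G) / 1026)
    (ENNReal.div_pos h0 (by simp))
  rw [← mul_div_assoc, ENNReal.le_div_iff_mul_le (by simp) (by simp), mul_comm] at this
  have hlt : 1025 * (P.prod Q) (E \ G) < 1026 * (P.prod Q) (E \ G) :=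
    ENNReal.mul_lt_mul_left h0 (measure_ne_top _ _) (by norm_num)
  exact absurd this (not_le.2 hlt)

theorem IsMarkovChain.isMarkovFrom {Ω : Type*} [MeasurableSpace Ω] {μ : Measure Ω}
    {X : ℕ → Ω → S} (hX : IsMarkovChain μ p X) :
    IsMarkovFrom p 0 (μ.map fun ω n => X n ω) := by
  intro n _ s
  have hm : Measurable fun ω n => X n ω := measurable_pi_lambda _ hX.measurable
  rw [Measure.map_apply hm (measurableSet_forall_le_coord_eq _ s),
    Measure.map_apply hm (measurableSet_forall_le_coord_eq _ s)]
  exact hX.markov n s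

end Localization

end LoopErasedWalk

theorem mainTheorem1 {S : Type*} [Countable S] [MeasurableSpace S] [DiscreteMeasurableSpace S]
    {Ω : Type*} [MeasurableSpace Ω] (μ : Measure Ω) [IsProbabilityMeasure μ]
    (p : S → PMF S) (X Y : ℕ → Ω → S)
    (hX : LoopErasedWalk.IsMarkovChain μ p X) (hY : LoopErasedWalk.IsMarkovChain μ p Y)
    (hXt : LoopErasedWalk.IsTransient μ X) (hYt : LoopErasedWalk.IsTransient μ Y)
    (hXY : IndepFun (fun ω n => X n ω) (fun ω n => Y n ω) μ) :
    ∀ᵐ ω ∂μ,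
      (Set.range (fun m => X m ω) ∩ Set.range (fun n => Y n ω)).Infinite →
      (Set.range (LoopErasedWalk.loopErasure (fun m => X m ω)) ∩
        Set.range (fun n => Y n ω)).Infinite := by
  have hXm : Measurable fun ω n => X n ω := measurable_pi_lambda _ hX.measurable
  have hYm : Measurable fun ω n => Y n ω := measurable_pi_lambda _ hY.measurable
  have hae := hX.isMarkovFrom.ae_mem_goodFrom hY.isMarkovFrom
  rw [← hXY.map_prod_eq_prod_map_map hXm.aemeasurable hYm.aemeasurable] at hae
  filter_upwards [ae_of_ae_map (hXm.prodMk hYm).aemeasurable hae, hYt] with ω hω hωY hinf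
  exact LoopErasedWalk.infinite_of_mem_goodFrom hωY
    (hω fun N => LoopErasedWalk.mem_meetFrom_of_infinite hinf N)
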